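/- **Setting.** For $X=[a\ e\ i\ \Omega\ \omega]^{\sf T}\in\mathbb R^5$, true anomaly $\theta\in\mathbb R$ and thrust per unit mass $U=[S\ T\ W]^{\sf T}\in\mathbb R^3$ consider the Gauss variational equations $\dot X=G(X,\theta)U$, $\dot\theta=g(X,\theta,U)$, where, with $\mu>0$, $p=a(1-e^2)$, $r=p/(1+e\cos\theta)$, $\psi=\arccos\left(\frac1e-\frac r{ae}\right)$, $h=\sqrt{\mu p}$, $$G=\begin{bmatrix}\frac{2a^2}{h}e\sin\theta&\frac{2a^2}{h}\frac pr&0\\ \frac{p\sin\theta}{h}&\frac{p(\cos\psi+\cos\theta)}{h}&0\\0&0&\frac rh\cos(\theta+\omega)\\0&0&\frac rh\frac{\sin(\theta+\omega)}{\sin i}\\-\frac{p\cos\theta}{eh}&\frac{(r+p)\sin\theta}{eh}&-\frac{r\sin(\theta+\omega)\cot i}{h}\end{bmatrix},\qquad g=\frac h{r^2}+\frac{p\cos\theta}{e}\frac Sh-\frac{p+r}{e}\sin\theta\,\frac Th .$$ Solutions are always understood to stay in the non-singular region $a>0$, $0<e<1$, $0<i<\pi$. Norms are Euclidean. Let $P=P^{\sf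 T}\succ0$, $q_1,q_2,U_{\max}>0$, $\epsilon_1,\epsilon_2,e_{\min}\ge0$, $r_{\min}\in\mathbb R$. Put $V_0(P,X,X_d)=\frac12(X-X_d)^{\sf T}P(X-X_d)$; $B_1(X)=\frac12q_1(a(1-e)-r_{\min}-\epsilon_1)^2$ if $a(1-e)<r_{\min}+\epsilon_1$ and $0$ otherwise; $B_2(X)=\frac12q_2(e-e_{\min}-\epsilon_2)^2$ if $e<e_{\min}+\epsilon_2$ and $0$ otherwise; $C=\nabla B_1+\nabla B_2$; $U_{\rm nom}(X,X_d,\theta)=-G^{\sf T}(X,\theta)\,[P(X-X_d)+C(X)]$. The closed loop with target $X_d$ uses $U=U_{\rm nom}$ if $\|U_{\rm nom}\|\le U_{\max}$ and $U=U_{\max}U_{\rm nom}/\|U_{\rm nom}\|$ otherwise. For a horizon $t_{\rm hor}>0$ let $\hat X(t+t_{\rm hor};t,X,\theta,X_d)$ be the state at time $t+t_{\rm hor}$ of the closed loop with constant target $X_d$ started at time $t$ from $(X,\theta)$; a condition on $\hat X$ includes that this solution exists on $[t,t+t_{\rm hor}]$. Let $Q(X_d)=\{X\in\mathbb R^5: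 V_0(P,X,X_d)\le c_0(X_d)\}$. **Governor.** Let $X_{\rm des}$ be the target, $t_0<t_1<\cdots\to\infty$, and let $\tilde X_0$ be the initial virtual target, with $$\hat X(t_n+t_{\rm hor};t_n,X(t_n),\theta(t_n),\tilde X_n)\in Q(\tilde X_n)\tag{T}$$ for $n=0$. On $[t_n,t_{n+1}]$, $(X,\theta)$ follows the closed loop with target $\tilde X_n$. At $t_n$, $n\ge1$, the governor takes the maximal $\kappa\in[0,1]$ for which $\tilde X_n=\tilde X_{n-1}+\kappa(X_{\rm des}-\tilde X_{n-1})$ satisfies (T), except that an adjustment with $\|\tilde X_n-\tilde X_{n-1}\|<\delta$ that does not reach $X_{\rm des}$ is rejected, i.e. then $\kappa=0$ and $\tilde X_n=\tilde X_{n-1}$. **Assumptions.** Let $\mathcal T$ be the segment from $\tilde X_0$ to $X_{\rm des}$; $c_0>0$ on $\mathcal T$. (A1) If $X_d\in\mathcal T$ and $X\in Q(X_d)$, then $B_1(X)=B_2(X)=0$. (A2) There is $\epsilon>0$ such that $\hat X(t+t_{\rm hor};t,X,\theta,X_d+\bar X)\in Q(X_d+\bar X)$ for all $t$, all $X_d\in\mathcal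 T$, $X\in Q(X_d)$, $\theta\in[0,2\pi)$ and all $\bar X$ with $\|\bar X\|\le\epsilon$ and $X_d+\bar X\in\mathcal T$. (A3) $\|U_{\rm nom}(X,X_{\rm des},\theta)\|\le U_{\max}$ for all $X\in Q(X_{\rm des})$, $\theta\in[0,2\pi)$. Moreover $0<\delta<\epsilon$. **Theorem.** 1. (Initial feasibility.) If $X(t_0)$ lies in the non-singular region, $B_1(X(t_0))=B_2(X(t_0))=0$ and $c_0(X(t_0))>0$, then $\tilde X_0=X(t_0)$ satisfies (T) for $n=0$. 2. (Positive invariance.) For every $X_d\in\mathcal T$, the closed loop with constant target $X_d$ has a solution for all future times from every $(X,\theta)$ with $X\in Q(X_d)$, and no solution leaves $Q(X_d)$. 3. (Recursive feasibility.) For every $N$, if the governed closed loop has been run up to time $t_N$, then (T) holds for $n=N$; with the target frozen at $\tilde X_N$ the closed loop continues for all times and lies in $Q(\tilde X_N)$ from time $t_N+t_{\rm hor}$ on; and $\kappa=0$ is feasible at the next sampling instant, whatever that instant is. 4. (Convergence.) If the governed closed loop is run for all $n$, then $\tilde X_n=X_{\rm des}$ for all sufficiently large $n$. Consequently, for all sufficiently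 large $t$, $X(t)\in Q(X_{\rm des})$, the applied control equals the nominal unconstrained law $U=-G^{\sf T}(X,\theta)P(X-X_{\rm des})$, and $(X,\theta)$ is a solution under that law. If in addition $G(X(t),\theta(t))$ is persistently exciting, i.e. there are $T,\alpha>0$ with $\int_t^{t+T}G(X(\tau),\theta(\tau))\,G(X(\tau),\theta(\tau))^{\sf T}\,d\tau\succeq\alpha I$ for all $t\ge t_0$, then $X(t)\to X_{\rm des}$ as $t\to\infty$. -/

import Mathlib

open Set Filter Topology

namespace OrbitalTransfer

/-- The slow orbital elements `X = [a, e, i, Ω, ω]`, with the Euclidean norm. -/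
abbrev State := EuclideanSpace ℝ (Fin 5)

/-- Thrust per unit mass `U = [S, T, W]`, with the Euclidean norm. -/
abbrev Control := EuclideanSpace ℝ (Fin 3)

/-- The constants of the model and of the controller. -/
structure Params where
  /-- gravitational parameter of the primary -/
  μ : ℝ
  /-- minimal radius of periapsis -/
  rmin : ℝ
  /-- minimal eccentricity -/
  emin : ℝ
  /-- safety margin for the radius of periapsis -/
  ε₁ : ℝ
  /-- safety margin for the eccentricity -/
  ε₂ : ℝ
  /-- weight of the first barrier function -/
  q₁ : ℝ
  /-- weight of the second barrier function -/
  q₂ : ℝ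
  /-- maximal thrust per unit mass -/
  Umax : ℝ
  /-- weight matrix of the nominal Lyapunov function -/
  P : Matrix (Fin 5) (Fin 5) ℝ
  μ_pos : 0 < μ
  emin_nonneg : 0 ≤ emin
  ε₁_nonneg : 0 ≤ ε₁
  ε₂_nonneg : 0 ≤ ε₂
  q₁_pos : 0 < q₁
  q₂_pos : 0 < q₂
  Umax_pos : 0 < Umax
  P_posDef : P.PosDef

noncomputable section

/-! ### Gauss variational equations -/

/-- The orbital elements for which the Gauss variational equations are non-singular:
elliptic, non-circular and non-equatorial orbits. -/
def Regular : Set State :=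
  {X | 0 < X 0 ∧ 0 < X 1 ∧ X 1 < 1 ∧ 0 < X 2 ∧ X 2 < Real.pi}

/-- Semi-latus rectum `p = a (1 - e²)`. -/
def semiLatus (X : State) : ℝ := X 0 * (1 - X 1 ^ 2)

/-- Distance to the centre of gravity, `r = p / (1 + e cos θ)`. -/
def radius (X : State) (θ : ℝ) : ℝ := semiLatus X / (1 + X 1 * Real.cos θ)

/-- Eccentric anomaly `ψ = arccos (1/e - r/(a e))`. -/
def eccAnomaly (X : State) (θ : ℝ) : ℝ :=
  Real.arccos (1 / X 1 - radius X θ / (X 0 * X 1))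

/-- The factor `√(μ p)`. -/
def angMom (par : Params) (X : State) : ℝ := Real.sqrt (par.μ * semiLatus X)

/-- The matrix `G(X, θ)` of the first five Gauss variational equations `X' = G(X, θ) U`. -/
def G (par : Params) (X : State) (θ : ℝ) : Matrix (Fin 5) (Fin 3) ℝ :=
  let a := X 0
  let e := X 1
  let i := X 2
  let ω := X 4
  let p := semiLatus X
  let r := radius X θ
  let ψ := eccAnomaly X θ
  let h := angMom par X
  !![2 * a ^ 2 / h * e * Real.sin θ, 2 * a ^ 2 / h * (p / r), 0;
     p * Real.sin θ / h, p * (Real.cos ψ + Real.cos θ) / h, 0;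
     0, 0, r / h * Real.cos (θ + ω);
     0, 0, r / h * (Real.sin (θ + ω) / Real.sin i);
     -(p * Real.cos θ / (e * h)), (r + p) * Real.sin θ / (e * h),
       -(r * Real.sin (θ + ω) * (Real.cos i / Real.sin i) / h)]

/-- The right-hand side of the Gauss variational equation for the true anomaly `θ`. -/
def anomalyRate (par : Params) (X : State) (θ : ℝ) (U : Control) : ℝ :=
  let e := X 1
  let p := semiLatus X
  let r := radius X θ
  let h := angMom par X
  h / r ^ 2 + p * Real.cos θ / e * (U 0 / h) - (p + r) / e * Real.sin θ * (U 1 / h)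

/-- `(x, ϑ)` solves, on the set `s` of times, the Gauss variational equations under the
feedback law `U = u(X, θ)`, and never meets a singularity of these equations. -/
def IsTrajectory (par : Params) (u : State → ℝ → Control) (x : ℝ → State) (ϑ : ℝ → ℝ)
    (s : Set ℝ) : Prop :=
  ∀ t ∈ s, x t ∈ Regular ∧
    HasDerivWithinAt x
      (WithLp.toLp 2 ((G par (x t) (ϑ t)).mulVec (u (x t) (ϑ t)).ofLp)) s t ∧
    HasDerivWithinAt ϑ (anomalyRate par (x t) (ϑ t) (u (x t) (ϑ t))) s t

/-! ### Lyapunov function, barrier functions and feedback law -/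

/-- Barrier function for the radius of periapsis `a (1 - e)`. -/
def B₁ (par : Params) (X : State) : ℝ :=
  if X 0 * (1 - X 1) < par.rmin + par.ε₁ then
    1 / 2 * par.q₁ * (X 0 * (1 - X 1) - par.rmin - par.ε₁) ^ 2
  else 0

/-- Barrier function for the eccentricity. -/
def B₂ (par : Params) (X : State) : ℝ :=
  if X 1 < par.emin + par.ε₂ then 1 / 2 * par.q₂ * (X 1 - par.emin - par.ε₂) ^ 2 else 0

/-- Gradient of `B₁`. -/
def gradB₁ (par : Params) (X : State) : Fin 5 → ℝ :=
  if X 0 * (1 - X 1) < par.rmin + par.ε₁ then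
    ![par.q₁ * (1 - X 1) * (X 0 * (1 - X 1) - par.rmin - par.ε₁),
      -(par.q₁ * X 0 * (X 0 * (1 - X 1) - par.rmin - par.ε₁)), 0, 0, 0]
  else 0

/-- Gradient of `B₂`. -/
def gradB₂ (par : Params) (X : State) : Fin 5 → ℝ :=
  if X 1 < par.emin + par.ε₂ then ![0, par.q₂ * (X 1 - par.emin - par.ε₂), 0, 0, 0] else 0

/-- Nominal Lyapunov function `V₀(P, X, Xd) = ½ (X - Xd)ᵀ P (X - Xd)`. -/
def V₀ (P : Matrix (Fin 5) (Fin 5) ℝ) (X Xd : State) : ℝ :=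
  1 / 2 * ((X - Xd).ofLp ⬝ᵥ P.mulVec (X - Xd).ofLp)

/-- The unsaturated law `U_nom = -[(X - Xd)ᵀ P G + Cᵀ G]ᵀ` with `C = ∇B₁ + ∇B₂`. -/
def Unom (par : Params) (Xd X : State) (θ : ℝ) : Control :=
  WithLp.toLp 2 (-((G par X θ).transpose.mulVec
    (par.P.mulVec (X - Xd).ofLp + (gradB₁ par X + gradB₂ par X))))

open Classical in
/-- The Lyapunov control law: `U_nom` saturated at norm `Umax`. -/
def Usat (par : Params) (Xd X : State) (θ : ℝ) : Control :=
  if ‖Unom par Xd X θ‖ ≤ par.Umax then Unom par Xd X θ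
  else (par.Umax / ‖Unom par Xd X θ‖) • Unom par Xd X θ

/-- The nominal unconstrained law `U = -Gᵀ P (X - Xd)`, without barrier terms and
saturation. -/
def Uunc (par : Params) (Xd X : State) (θ : ℝ) : Control :=
  WithLp.toLp 2 (-((G par X θ).transpose.mulVec (par.P.mulVec (X - Xd).ofLp)))

/-! ### Terminal sets, predictions and the standing assumptions -/

/-- The terminal set `Q(Xd)`, a sublevel set of `V₀` of level `c₀(Xd)`. -/
def Q (par : Params) (c₀ : State → ℝ) (Xd : State) : Set State :=
  {X | V₀ par.P X Xd ≤ c₀ Xd}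

/-- `Y` is the predicted state at time `t'` of the closed loop with constant target `Xd`
that starts at time `t` from the state `X` and the true anomaly `θ`. -/
def IsPrediction (par : Params) (t' t : ℝ) (X : State) (θ : ℝ) (Xd Y : State) : Prop :=
  ∃ (x : ℝ → State) (ϑ : ℝ → ℝ), IsTrajectory par (Usat par Xd) x ϑ (Icc t t') ∧
    x t = X ∧ ϑ t = θ ∧ x t' = Y

/-- The terminal-set condition: the prediction with target `Xd` exists over the horizon
`thor` and ends in `Q(Xd)`. -/
def TerminalCond (par : Params) (c₀ : State → ℝ) (thor t : ℝ) (X : State) (θ : ℝ)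
    (Xd : State) : Prop :=
  ∃ Y ∈ Q par c₀ Xd, IsPrediction par (t + thor) t X θ Xd Y

/-- (A1): the barrier functions vanish on the terminal sets of all virtual targets in `𝒯`. -/
def A1 (par : Params) (c₀ : State → ℝ) (𝒯 : Set State) : Prop :=
  ∀ Xd ∈ 𝒯, ∀ X ∈ Q par c₀ Xd, B₁ par X = 0 ∧ B₂ par X = 0

/-- (A2): from every state in the terminal set of a virtual target in `𝒯`, every adjustment
of that target within `𝒯` by at most `ε` satisfies the terminal-set condition. -/
def A2 (par : Params) (c₀ : State → ℝ) (thor : ℝ) (𝒯 : Set State) (ε : ℝ) : Prop :=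
  ∀ Xd ∈ 𝒯, ∀ (t : ℝ), ∀ X ∈ Q par c₀ Xd, ∀ θ ∈ Ico 0 (2 * Real.pi),
    ∀ Xbar : State, ‖Xbar‖ ≤ ε → Xd + Xbar ∈ 𝒯 →
      TerminalCond par c₀ thor t X θ (Xd + Xbar)

/-- (A3): the control constraint is inactive on `Q(Xdes)`. -/
def A3 (par : Params) (c₀ : State → ℝ) (Xdes : State) : Prop :=
  ∀ X ∈ Q par c₀ Xdes, ∀ θ ∈ Ico 0 (2 * Real.pi), ‖Unom par Xdes X θ‖ ≤ par.Umax

/-! ### The reference governor -/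

/-- The target obtained from `Xprev` with the parameter `κ`. -/
def adjust (Xdes Xprev : State) (κ : ℝ) : State := Xprev + κ • (Xdes - Xprev)

/-- The values of `κ` that are feasible at time `t`, state `X`, true anomaly `θ` and
previous virtual target `Xprev`. -/
def feasible (par : Params) (c₀ : State → ℝ) (thor : ℝ) (Xdes : State) (t : ℝ) (X : State)
    (θ : ℝ) (Xprev : State) : Set ℝ :=
  {κ | κ ∈ Icc (0 : ℝ) 1 ∧ TerminalCond par c₀ thor t X θ (adjust Xdes Xprev κ)}

/-- `κ` is the governor's choice: the maximal feasible value `κmax`, unless this would move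
the virtual target by less than `δ` without reaching `Xdes`; such a move is rejected. -/
def IsGovernorChoice (par : Params) (c₀ : State → ℝ) (thor δ : ℝ) (Xdes : State) (t : ℝ)
    (X : State) (θ : ℝ) (Xprev : State) (κ : ℝ) : Prop :=
  ∃ κmax, IsGreatest (feasible par c₀ thor Xdes t X θ Xprev) κmax ∧
    ((δ ≤ ‖adjust Xdes Xprev κmax - Xprev‖ ∨ adjust Xdes Xprev κmax = Xdes) → κ = κmax) ∧
    (¬(δ ≤ ‖adjust Xdes Xprev κmax - Xprev‖ ∨ adjust Xdes Xprev κmax = Xdes) → κ = 0)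

/-- The governed closed loop up to the time `t N`. The initial virtual target satisfies the
terminal-set condition; between `t n` and `t (n + 1)` the state follows the closed loop with
target `Xt n`; at `t (n + 1)` the governor chooses `κ (n + 1)` and thereby `Xt (n + 1)`. -/
structure IsGovernedUpTo (par : Params) (c₀ : State → ℝ) (thor δ : ℝ) (Xdes : State)
    (t : ℕ → ℝ) (X : ℝ → State) (θ : ℝ → ℝ) (κ : ℕ → ℝ) (Xt : ℕ → State) (N : ℕ) :
    Prop where
  init : TerminalCond par c₀ thor (t 0) (X (t 0)) (θ (t 0)) (Xt 0)
  dynamics : ∀ n < N, IsTrajectory par (Usat par (Xt n)) X θ (Icc (t n) (t (n + 1)))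
  choice : ∀ n < N, IsGovernorChoice par c₀ thor δ Xdes (t (n + 1)) (X (t (n + 1)))
    (θ (t (n + 1))) (Xt n) (κ (n + 1))
  target : ∀ n < N, Xt (n + 1) = adjust Xdes (Xt n) (κ (n + 1))

/-- Persistence of excitation of `Γ` on `[t₀, ∞)`: for some `T, α > 0`,
`∫_t^{t+T} Γ Γᵀ ⪰ α I` for all `t ≥ t₀`. -/
def PersistentlyExciting (Γ : ℝ → Matrix (Fin 5) (Fin 3) ℝ) (t₀ : ℝ) : Prop :=
  ∃ T > 0, ∃ α > 0, ∀ t ≥ t₀,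
    ((Matrix.of fun i j => ∫ τ in t..(t + T), (Γ τ * (Γ τ).transpose) i j)
      - α • (1 : Matrix (Fin 5) (Fin 5) ℝ)).PosSemidef

end

end OrbitalTransfer

open OrbitalTransfer

/-! Along the closed loop, `V₀ + B₁ + B₂` has derivative `-c |Gᵀ w|²`, where `w` is its gradient and
`c ≥ 0` the saturation factor, so it never increases (`antitoneOn_lyapunov`). On a terminal set the
barriers vanish by (A1), hence `V₀` cannot exceed its starting value and the set is invariant
(`A1.mem_Q`). Global existence needs no a priori bound: (A2) with zero adjustment supplies, from
each point of a terminal set, a solution over one horizon that ends in the same set, and such pieces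
are chained. Predictions are identified with the actual motion by uniqueness, for which the
closed-loop field is shown to be locally Lipschitz; barriers and saturation leave it only that
regular.

Once a prediction has entered its terminal set it stays there, so the prediction from a later
instant also ends in the set: keeping the target is always feasible (`TerminalCond.of_trajectory`).
Every accepted move short of `Xdes` brings the virtual target at least `δ` closer, so there are
finitely many. If they stopped elsewhere, the state would enter the terminal set of the frozen
target, where (A2) permits a move of length `ε > δ` or a move onto `Xdes`; the governor would then
move, a contradiction (`eventually_target_eq`).

With the target at `Xdes`, (A1) and (A3) leave `x' = -Γ Γᵀ P (x - xd)`, and `V₀' = -|g|²` for `g =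
Γᵀ P (x - xd)`. Since `V₀` converges, its decrease over a window tends to zero. As `Γ` is bounded,
`x` then hardly moves within a window, so `P (x - xd)` may be frozen there, and persistent
excitation forces it to zero (`tendsto_of_excitation`). -/

namespace OrbitalTransfer

/-! ### Locally Lipschitz maps -/

section LipAt

variable {E E' E'' : Type*} [NormedAddCommGroup E] [NormedAddCommGroup E'] [NormedAddCommGroup E'']

/-- `f` is Lipschitz on some neighbourhood of `x`. -/
def LipAt (f : E → E') (x : E) : Prop :=
  ∃ K, ∃ s ∈ 𝓝 x, LipschitzOnWith K f s

theorem LipAt.continuousAt {f : E → E'} {x : E} (hf : LipAt f x) : ContinuousAt f x := by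
  obtain ⟨K, s, hs, h⟩ := hf
  exact h.continuousOn.continuousAt hs

theorem LipAt.comp {g : E' → E''} {f : E → E'} {x : E} (hg : LipAt g (f x)) (hf : LipAt f x) :
    LipAt (fun y => g (f y)) x := by
  have hc := hf.continuousAt
  obtain ⟨K, s, hs, h⟩ := hf
  obtain ⟨K', s', hs', h'⟩ := hg
  refine ⟨K' * K, s ∩ f ⁻¹' s', inter_mem hs (hc hs'), ?_⟩
  exact h'.comp (h.mono inter_subset_left) fun y hy => hy.2

theorem LipAt.prodMk {f : E → E'} {g : E → E''} {x : E} (hf : LipAt f x) (hg : LipAt g x) :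
    LipAt (fun y => (f y, g y)) x := by
  obtain ⟨K, s, hs, h⟩ := hf
  obtain ⟨K', s', hs', h'⟩ := hg
  exact ⟨max K K', s ∩ s', inter_mem hs hs',
    (h.mono inter_subset_left).prodMk (h'.mono inter_subset_right)⟩

theorem LipAt.congr {f g : E → E'} {x : E} (hf : LipAt f x) (hfg : g =ᶠ[𝓝 x] f) :
    LipAt g x := by
  obtain ⟨K, s, hs, h⟩ := hf
  refine ⟨K, s ∩ {y | g y = f y}, inter_mem hs hfg, ?_⟩
  intro y hy y' hy'
  rw [show g y = f y from hy.2, show g y' = f y' from hy'.2]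
  exact h hy.1 hy'.1

theorem lipAt_of_lipschitzWith {K} {f : E → E'} (hf : LipschitzWith K f) (x : E) : LipAt f x :=
  ⟨K, univ, univ_mem, hf.lipschitzOnWith⟩

theorem lipAt_of_contDiffAt [NormedSpace ℝ E] [NormedSpace ℝ E'] {f : E → E'} {x : E}
    (hf : ContDiffAt ℝ 1 f x) : LipAt f x :=
  hf.exists_lipschitzOnWith

end LipAt

/-! ### Autonomous differential equations confined to a region -/

section SolvesOn

variable {E : Type*} [NormedAddCommGroup E] [NormedSpace ℝ E] {F : E → E} {R : Set E}
  {z w : ℝ → E} {s : Set ℝ} {a b c : ℝ}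

/-- `z` solves `z' = F(z)` on the set `s` of times and stays in the region `R`. -/
def SolvesOn (F : E → E) (R : Set E) (z : ℝ → E) (s : Set ℝ) : Prop :=
  ∀ t ∈ s, z t ∈ R ∧ HasDerivWithinAt z (F (z t)) s t

theorem SolvesOn.continuousOn (h : SolvesOn F R z s) : ContinuousOn z s :=
  fun t ht => (h t ht).2.continuousWithinAt

theorem SolvesOn.mono {s' : Set ℝ} (h : SolvesOn F R z s) (hs : s' ⊆ s) : SolvesOn F R z s' :=
  fun t ht => ⟨(h t (hs ht)).1, (h t (hs ht)).2.mono hs⟩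

theorem SolvesOn.congr (h : SolvesOn F R z s) (hzw : EqOn w z s) : SolvesOn F R w s := by
  intro t ht
  rw [hzw ht]
  exact ⟨(h t ht).1, (h t ht).2.congr (fun y hy => hzw hy) (hzw ht)⟩

theorem SolvesOn.union_Icc (hab : a ≤ b) (h₁ : SolvesOn F R z (Icc a b))
    (h₂ : SolvesOn F R z (Icc b c)) : SolvesOn F R z (Icc a c) := by
  intro t ht
  have hR : z t ∈ R := by
    rcases le_total t b with h | h
    · exact (h₁ t ⟨ht.1, h⟩).1
    · exact (h₂ t ⟨h, ht.2⟩).1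
  refine ⟨hR, ?_⟩
  rcases lt_trichotomy t b with h | rfl | h
  · refine ((h₁ t ⟨ht.1, h.le⟩).2).mono_of_mem_nhdsWithin ?_
    filter_upwards [self_mem_nhdsWithin, nhdsWithin_le_nhds (Iio_mem_nhds h)] with y hy hy'
    exact ⟨hy.1, (mem_Iio.1 hy').le⟩
  · have := (h₁ t ⟨ht.1, le_rfl⟩).2.union (h₂ t ⟨le_rfl, ht.2⟩).2
    rwa [Icc_union_Icc_eq_Icc ht.1 ht.2] at this
  · refine ((h₂ t ⟨h.le, ht.2⟩).2).mono_of_mem_nhdsWithin ?_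
    filter_upwards [self_mem_nhdsWithin, nhdsWithin_le_nhds (Ioi_mem_nhds h)] with y hy hy'
    exact ⟨(mem_Ioi.1 hy').le, hy.2⟩

/-- Two solutions that agree at the common end point can be concatenated. -/
theorem SolvesOn.glue (hab : a ≤ b) (h₁ : SolvesOn F R z (Icc a b))
    (h₂ : SolvesOn F R w (Icc b c)) (hb : z b = w b) :
    ∃ v, SolvesOn F R v (Icc a c) ∧ EqOn v z (Icc a b) ∧ EqOn v w (Icc b c) := by
  classical
  have e₁ : EqOn (fun t => if t ≤ b then z t else w t) z (Icc a b) := fun t ht => if_pos ht.2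
  have e₂ : EqOn (fun t => if t ≤ b then z t else w t) w (Icc b c) := by
    intro t ht
    by_cases h : t ≤ b
    · obtain rfl := le_antisymm h ht.1
      simp [hb]
    · exact if_neg h
  exact ⟨_, (h₁.congr e₁).union_Icc hab (h₂.congr e₂), e₁, e₂⟩

theorem SolvesOn.Ici_of_Icc (h : ∀ b, SolvesOn F R z (Icc a b)) : SolvesOn F R z (Ici a) := by
  intro t ht
  obtain ⟨hR, hd⟩ := h (t + 1) t ⟨ht, by linarith⟩
  refine ⟨hR, hd.mono_of_mem_nhdsWithin ?_⟩
  filter_upwards [self_mem_nhdsWithin,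
    nhdsWithin_le_nhds (Iio_mem_nhds (lt_add_one t))] with y hy hy'
  exact ⟨hy, (mem_Iio.1 hy').le⟩

/-- Uniqueness of solutions for locally Lipschitz vector fields. -/
theorem SolvesOn.eqOn (hF : ∀ y ∈ R, LipAt F y) (hz : SolvesOn F R z (Icc a b))
    (hw : SolvesOn F R w (Icc a b)) (h0 : z a = w a) : EqOn z w (Icc a b) := by
  have hcl : IsClosed ({t | z t = w t} ∩ Icc a b) := by
    have : {t | z t = w t} ∩ Icc a b = {t ∈ Icc a b | z t = w t} := by
      ext t; exact and_comm
    rw [this]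
    have hc : ContinuousOn (fun t => z t - w t) (Icc a b) :=
      hz.continuousOn.fun_sub hw.continuousOn
    have := hc.preimage_isClosed_of_isClosed isClosed_Icc (isClosed_singleton (x := (0 : E)))
    convert this using 1
    ext t
    simp [sub_eq_zero]
  -- Continuous induction: the agreement set is closed and contains `a`, so it suffices to extend
  -- agreement slightly to the right of each of its points, where both solutions remain in one
  -- Lipschitz neighbourhood.
  refine hcl.Icc_subset_of_forall_mem_nhdsWithin h0 ?_
  rintro t ⟨hzw, hta, htb⟩
  have htI : t ∈ Icc a b := ⟨hta, htb.le⟩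
  obtain ⟨K, U, hU, hK⟩ := hF _ (hz t htI).1
  have key : ∀ {v : ℝ → E}, SolvesOn F R v (Icc a b) → v t = z t →
      ∀ᶠ c in 𝓝[≥] t, v c ∈ U := by
    intro v hv hvt
    have hcont : ContinuousWithinAt v (Ici t) t :=
      (hv t htI).2.continuousWithinAt.mono_of_mem_nhdsWithin
        (Icc_mem_nhdsGE_of_mem ⟨hta, htb⟩)
    exact hcont (by rw [hvt]; exact hU)
  have hev : ∀ᶠ c in 𝓝[≥] t, z c ∈ U ∧ w c ∈ U ∧ c < b :=
    (key hz rfl).and ((key hw hzw.symm).and (nhdsWithin_le_nhds (Iio_mem_nhds htb)))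
  obtain ⟨d, hd, hsub⟩ := mem_nhdsGE_iff_exists_Icc_subset.1 hev
  have hd' : t < d := hd
  have hI : Icc t d ⊆ Icc a b := fun c hc =>
    ⟨hta.trans hc.1, (hsub hc).2.2.le⟩
  have right : ∀ {v : ℝ → E}, SolvesOn F R v (Icc a b) → ∀ c ∈ Ico t d,
      HasDerivWithinAt v (F (v c)) (Ici c) c := by
    intro v hv c hc
    have hc' := hsub ⟨hc.1, hc.2.le⟩
    exact (hv c (hI ⟨hc.1, hc.2.le⟩)).2.mono_of_mem_nhdsWithin
      (Icc_mem_nhdsGE_of_mem ⟨hta.trans hc.1, hc'.2.2⟩)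
  have := ODE_solution_unique_of_mem_Icc_right (v := fun _ => F) (s := fun _ => U) (K := K)
    (fun _ _ => hK) (hz.continuousOn.mono hI) (right hz)
    (fun c hc => (hsub ⟨hc.1, hc.2.le⟩).1) (hw.continuousOn.mono hI) (right hw)
    (fun c hc => (hsub ⟨hc.1, hc.2.le⟩).2.1) hzw
  exact mem_of_superset (Ioc_mem_nhdsGT hd') fun c hc => this ⟨hc.1.le, hc.2⟩

/-- Solutions on arbitrarily long intervals give a solution for all future times. -/
theorem SolvesOn.exists_Ici (hF : ∀ y ∈ R, LipAt F y) {z₀ : E}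
    (h : ∀ n : ℕ, ∃ z, SolvesOn F R z (Icc a (a + n)) ∧ z a = z₀) :
    ∃ z, SolvesOn F R z (Ici a) ∧ z a = z₀ := by
  choose z hz hz0 using h
  have agree : ∀ m n : ℕ, m ≤ n → EqOn (z m) (z n) (Icc a (a + m)) := fun m n hmn =>
    (hz m).eqOn hF ((hz n).mono (Icc_subset_Icc_right (by gcongr))) (by rw [hz0, hz0])
  -- By `agree`, any index at least `t - a` gives the same value; the ceiling is the least such
  -- index.
  let v : ℝ → E := fun t => z ⌈t - a⌉₊ t
  have hv : ∀ n : ℕ, EqOn v (z n) (Icc a (a + n)) := by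
    intro n t ht
    refine agree _ n (Nat.ceil_le.2 (by linarith [ht.2])) ⟨ht.1, ?_⟩
    linarith [Nat.le_ceil (t - a)]
  refine ⟨v, SolvesOn.Ici_of_Icc fun b => ?_, ?_⟩
  · refine ((hz ⌈b - a⌉₊).congr (hv _)).mono (Icc_subset_Icc_right ?_)
    linarith [Nat.le_ceil (b - a)]
  · rw [hv 0 ⟨le_rfl, by simp⟩, hz0]

/-- If from every state in `S` there is a solution over the horizon `h` that ends in `S`, then from
every state in `S` there is a solution for all future times. -/
theorem SolvesOn.exists_Ici_of_step (hF : ∀ y ∈ R, LipAt F y) {S : Set E} {h : ℝ} (hh : 0 < h)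
    (step : ∀ t, ∀ y ∈ S, ∃ z, SolvesOn F R z (Icc t (t + h)) ∧ z t = y ∧ z (t + h) ∈ S)
    {z₀ : E} (hz₀ : z₀ ∈ S) (a : ℝ) :
    ∃ z, SolvesOn F R z (Ici a) ∧ z a = z₀ := by
  have iter : ∀ n : ℕ, ∃ z, SolvesOn F R z (Icc a (a + (n + 1) * h)) ∧ z a = z₀ ∧
      z (a + (n + 1) * h) ∈ S := by
    intro n
    induction n with
    | zero => simpa using step a z₀ hz₀
    | succ n ih =>
      obtain ⟨z, hz, hz0, hzS⟩ := ih
      obtain ⟨w, hw, hw0, hwS⟩ := step _ _ hzS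
      have hle : a ≤ a + (n + 1) * h := by
        have : 0 ≤ ((n : ℝ) + 1) * h := by positivity
        linarith
      obtain ⟨v, hv, e₁, e₂⟩ := hz.glue hle hw hw0.symm
      have hend : a + ((n + 1 : ℕ) + 1 : ℝ) * h = a + (n + 1) * h + h := by push_cast; ring
      rw [hend]
      exact ⟨v, hv, by rw [e₁ ⟨le_rfl, hle⟩, hz0],
        by rwa [e₂ ⟨by linarith, le_rfl⟩]⟩
  refine SolvesOn.exists_Ici hF fun n => ?_
  obtain ⟨m, hm⟩ := exists_nat_ge (n / h)
  obtain ⟨z, hz, hz0, -⟩ := iter m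
  refine ⟨z, hz.mono (Icc_subset_Icc_right ?_), hz0⟩
  rw [div_le_iff₀ hh] at hm
  nlinarith

/-- A Lipschitz and bounded autonomous vector field has solutions on every compact interval. -/
theorem exists_solution_of_lipschitz_of_bounded [CompleteSpace E] {K : NNReal}
    (hK : LipschitzWith K F) {L : ℝ} (hL : ∀ y, ‖F y‖ ≤ L) (hab : a ≤ b) (z₀ : E) :
    ∃ z : ℝ → E, z a = z₀ ∧ ∀ t ∈ Icc a b, HasDerivWithinAt z (F (z t)) (Icc a b) t := by
  have hL0 : 0 ≤ L := (norm_nonneg _).trans (hL z₀)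
  -- A solution of speed at most `L` moves at most `L * (b - a)`; with this radius the local
  -- existence theorem covers all of `[a, b]`.
  have hpl : IsPicardLindelof (fun _ => F) (⟨a, le_rfl, hab⟩ : Icc a b) z₀
      (⟨L * (b - a), mul_nonneg hL0 (sub_nonneg.2 hab)⟩ : NNReal) 0 ⟨L, hL0⟩ K :=
    { lipschitzOnWith := fun _ _ => hK.lipschitzOnWith
      continuousOn := fun _ _ => continuousOn_const
      norm_le := fun _ _ y _ => hL y
      mul_max_le := by
        simp only [sub_self, max_eq_left (sub_nonneg.2 hab), NNReal.coe_zero, sub_zero]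
        exact le_rfl }
  exact hpl.exists_eq_forall_mem_Icc_hasDerivWithinAt₀

end SolvesOn

/-! ### Regularity of the Gauss variational equations -/

theorem isOpen_regular : IsOpen Regular := by
  have h : ∀ i : Fin 5, Continuous fun X : State => X i := fun i => by fun_prop
  simp only [Regular, ofPred_and]
  exact (isOpen_lt continuous_const (h 0)).inter <| (isOpen_lt continuous_const (h 1)).inter <|
    (isOpen_lt (h 1) continuous_const).inter <| (isOpen_lt continuous_const (h 2)).inter <|
    isOpen_lt (h 2) continuous_const

theorem one_add_mul_cos_pos {X : State} (hX : X ∈ Regular) (θ : ℝ) :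
    0 < 1 + X 1 * Real.cos θ := by
  obtain ⟨-, h1, h2, -⟩ := hX
  nlinarith [Real.neg_one_le_cos θ]

theorem semiLatus_pos {X : State} (hX : X ∈ Regular) : 0 < semiLatus X := by
  obtain ⟨h0, h1, h2, -⟩ := hX
  have : X 1 ^ 2 < 1 := by nlinarith
  exact mul_pos h0 (by linarith)

theorem radius_pos {X : State} (hX : X ∈ Regular) (θ : ℝ) : 0 < radius X θ :=
  div_pos (semiLatus_pos hX) (one_add_mul_cos_pos hX θ)

theorem angMom_pos (par : Params) {X : State} (hX : X ∈ Regular) : 0 < angMom par X :=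
  Real.sqrt_pos.2 (mul_pos par.μ_pos (semiLatus_pos hX))

/-- `arccos` is not differentiable at `±1`, values its argument takes when `cos θ = ±1`. Only `cos
ψ` enters `G`, and this rational expression for it is smooth. -/
theorem cos_eccAnomaly {X : State} (hX : X ∈ Regular) (θ : ℝ) :
    Real.cos (eccAnomaly X θ) = (X 1 + Real.cos θ) / (1 + X 1 * Real.cos θ) := by
  have hd := one_add_mul_cos_pos hX θ
  obtain ⟨h0, h1, h2, -⟩ := hX
  have hval : 1 / X 1 - radius X θ / (X 0 * X 1)
      = (X 1 + Real.cos θ) / (1 + X 1 * Real.cos θ) := by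
    unfold radius semiLatus
    have h0' := h0.ne'
    have h1' := h1.ne'
    have hd' := hd.ne'
    field_simp
    ring
  have c1 := Real.neg_one_le_cos θ
  have c2 := Real.cos_le_one θ
  rw [eccAnomaly, hval, Real.cos_arccos]
  · rw [le_div_iff₀ hd]; nlinarith
  · rw [div_le_iff₀ hd]; nlinarith

theorem contDiffAt_semiLatus (z : State × ℝ) :
    ContDiffAt ℝ 1 (fun z : State × ℝ => semiLatus z.1) z := by
  unfold semiLatus; fun_prop

theorem contDiffAt_radius {z : State × ℝ} (hz : z.1 ∈ Regular) :
    ContDiffAt ℝ 1 (fun z : State × ℝ => radius z.1 z.2) z := by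
  unfold radius
  exact (contDiffAt_semiLatus z).div (by fun_prop) (one_add_mul_cos_pos hz _).ne'

theorem contDiffAt_angMom (par : Params) {z : State × ℝ} (hz : z.1 ∈ Regular) :
    ContDiffAt ℝ 1 (fun z : State × ℝ => angMom par z.1) z := by
  unfold angMom
  exact (contDiffAt_const.mul (contDiffAt_semiLatus z)).sqrt
    (mul_pos par.μ_pos (semiLatus_pos hz)).ne'

theorem eventually_regular {z : State × ℝ} (hz : z.1 ∈ Regular) :
    ∀ᶠ y : State × ℝ in 𝓝 z, y.1 ∈ Regular :=
  continuous_fst.continuousAt (isOpen_regular.mem_nhds hz)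

theorem contDiffAt_cos_eccAnomaly {z : State × ℝ} (hz : z.1 ∈ Regular) :
    ContDiffAt ℝ 1 (fun z : State × ℝ => Real.cos (eccAnomaly z.1 z.2)) z := by
  have : ContDiffAt ℝ 1
      (fun z : State × ℝ => (z.1 1 + Real.cos z.2) / (1 + z.1 1 * Real.cos z.2)) z :=
    ContDiffAt.div (by fun_prop) (by fun_prop) (one_add_mul_cos_pos hz _).ne'
  refine this.congr_of_eventuallyEq ?_
  filter_upwards [eventually_regular hz] with y hy
  exact cos_eccAnomaly hy _

/-- The entries of `G` are continuously differentiable in the non-singular region. -/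
theorem contDiffAt_G (par : Params) {z : State × ℝ} (hz : z.1 ∈ Regular) (i : Fin 5) (j : Fin 3) :
    ContDiffAt ℝ 1 (fun z : State × ℝ => G par z.1 z.2 i j) z := by
  have hp := contDiffAt_semiLatus z
  have hr := contDiffAt_radius hz
  have hh := contDiffAt_angMom par hz
  have hψ := contDiffAt_cos_eccAnomaly hz
  have hh0 := (angMom_pos par hz).ne'
  have hr0 := (radius_pos hz z.2).ne'
  have he0 : z.1 1 ≠ 0 := hz.2.1.ne'
  have hi0 : Real.sin (z.1 2) ≠ 0 := (Real.sin_pos_of_pos_of_lt_pi hz.2.2.2.1 hz.2.2.2.2).ne'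
  have heh0 := mul_ne_zero he0 hh0
  have hc : ContDiffAt ℝ 1 (fun z : State × ℝ => Real.cos z.2) z := by fun_prop
  have hs : ContDiffAt ℝ 1 (fun z : State × ℝ => Real.sin z.2) z := by fun_prop
  have ha : ContDiffAt ℝ 1 (fun z : State × ℝ => 2 * z.1 0 ^ 2) z := by fun_prop
  have he : ContDiffAt ℝ 1 (fun z : State × ℝ => z.1 1) z := by fun_prop
  have hcω : ContDiffAt ℝ 1 (fun z : State × ℝ => Real.cos (z.2 + z.1 4)) z := by fun_prop
  have hsω : ContDiffAt ℝ 1 (fun z : State × ℝ => Real.sin (z.2 + z.1 4)) z := by fun_prop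
  have hci : ContDiffAt ℝ 1 (fun z : State × ℝ => Real.cos (z.1 2)) z := by fun_prop
  have hsi : ContDiffAt ℝ 1 (fun z : State × ℝ => Real.sin (z.1 2)) z := by fun_prop
  fin_cases i <;> fin_cases j <;> simp [G]
  · exact ((ha.div hh hh0).mul he).mul hs
  · exact (ha.div hh hh0).mul (hp.div hr hr0)
  · exact contDiffAt_const
  · exact (hp.mul hs).div hh hh0
  · exact (hp.mul (hψ.add hc)).div hh hh0
  · exact contDiffAt_const
  · exact contDiffAt_const
  · exact contDiffAt_const
  · exact (hr.div hh hh0).mul hcω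
  · exact contDiffAt_const
  · exact contDiffAt_const
  · exact (hr.div hh hh0).mul (hsω.div hsi hi0)
  · exact ((hp.mul hc).div (he.mul hh) heh0).neg
  · exact ((hr.add hp).mul hs).div (he.mul hh) heh0
  · exact (((hr.mul hsω).mul (hci.div hsi hi0)).div hh hh0).neg

theorem contDiffAt_G_mulVec (par : Params) {y : (State × ℝ) × Control} (hy : y.1.1 ∈ Regular) :
    ContDiffAt ℝ 1 (fun y : (State × ℝ) × Control =>
      (WithLp.toLp 2 ((G par y.1.1 y.1.2).mulVec y.2.ofLp) : State)) y := by
  rw [contDiffAt_euclidean]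
  intro i
  simp only [Matrix.mulVec, dotProduct]
  refine ContDiffAt.sum fun j _ => ?_
  refine ContDiffAt.mul ?_ (by fun_prop)
  exact (contDiffAt_G par hy i j).comp y contDiffAt_fst

theorem contDiffAt_anomalyRate (par : Params) {y : (State × ℝ) × Control}
    (hy : y.1.1 ∈ Regular) :
    ContDiffAt ℝ 1 (fun y : (State × ℝ) × Control => anomalyRate par y.1.1 y.1.2 y.2) y := by
  have hp : ContDiffAt ℝ 1 (fun y : (State × ℝ) × Control => semiLatus y.1.1) y :=
    (contDiffAt_semiLatus y.1).comp y contDiffAt_fst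
  have hr : ContDiffAt ℝ 1 (fun y : (State × ℝ) × Control => radius y.1.1 y.1.2) y :=
    (contDiffAt_radius hy).comp y contDiffAt_fst
  have hh : ContDiffAt ℝ 1 (fun y : (State × ℝ) × Control => angMom par y.1.1) y :=
    (contDiffAt_angMom par hy).comp y contDiffAt_fst
  have hh0 := (angMom_pos par hy).ne'
  have hr0 := pow_ne_zero 2 (radius_pos hy y.1.2).ne'
  have he0 : y.1.1 1 ≠ 0 := hy.2.1.ne'
  have hc : ContDiffAt ℝ 1 (fun y : (State × ℝ) × Control => Real.cos y.1.2) y := by fun_prop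
  have hs : ContDiffAt ℝ 1 (fun y : (State × ℝ) × Control => Real.sin y.1.2) y := by fun_prop
  have he : ContDiffAt ℝ 1 (fun y : (State × ℝ) × Control => y.1.1 1) y := by fun_prop
  have hS : ContDiffAt ℝ 1 (fun y : (State × ℝ) × Control => y.2 0) y := by fun_prop
  have hT : ContDiffAt ℝ 1 (fun y : (State × ℝ) × Control => y.2 1) y := by fun_prop
  exact ((hh.div (hr.pow 2) hr0).add (((hp.mul hc).div he he0).mul (hS.div hh hh0))).sub
    ((((hp.add hr).div he he0).mul hs).mul (hT.div hh hh0))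

/-- The vector field of the closed loop under the feedback law `u`. -/
noncomputable def loopField (par : Params) (u : State → ℝ → Control) (z : State × ℝ) :
    State × ℝ :=
  (WithLp.toLp 2 ((G par z.1 z.2).mulVec (u z.1 z.2).ofLp), anomalyRate par z.1 z.2 (u z.1 z.2))

theorem lipAt_loopField (par : Params) {u : State → ℝ → Control} {z : State × ℝ}
    (hz : z.1 ∈ Regular) (hu : LipAt (fun z : State × ℝ => u z.1 z.2) z) :
    LipAt (loopField par u) z := by
  have h1 : LipAt (fun y : State × ℝ => (y, u y.1 y.2)) z :=
    (lipAt_of_lipschitzWith LipschitzWith.id z).prodMk hu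
  have h2 := (contDiffAt_G_mulVec par (y := (z, u z.1 z.2)) hz).prodMk
    (contDiffAt_anomalyRate par (y := (z, u z.1 z.2)) hz)
  exact LipAt.comp (f := fun y : State × ℝ => (y, u y.1 y.2)) (lipAt_of_contDiffAt h2) h1

/-! ### Regularity of the feedback law -/

/-- The case distinction becomes a single formula whose only non-smooth ingredient is the
1-Lipschitz map `min · 0`. -/
theorem gradB₁_eq (par : Params) (X : State) :
    gradB₁ par X = min (X 0 * (1 - X 1) - par.rmin - par.ε₁) 0 •
      ![par.q₁ * (1 - X 1), -(par.q₁ * X 0), 0, 0, 0] := by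
  unfold gradB₁
  split_ifs with h
  · rw [min_eq_left (by linarith)]
    ext i; fin_cases i <;> simp <;> ring
  · rw [min_eq_right (by linarith), zero_smul]

theorem gradB₂_eq (par : Params) (X : State) :
    gradB₂ par X = min (X 1 - par.emin - par.ε₂) 0 • ![0, par.q₂, 0, 0, 0] := by
  unfold gradB₂
  split_ifs with h
  · rw [min_eq_left (by linarith)]
    ext i; fin_cases i <;> simp; ring
  · rw [min_eq_right (by linarith), zero_smul]

theorem Usat_eq (par : Params) (Xd X : State) (θ : ℝ) :
    Usat par Xd X θ =
      (par.Umax / max par.Umax ‖Unom par Xd X θ‖) • Unom par Xd X θ := by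
  unfold Usat
  split_ifs with h
  · rw [max_eq_left h, div_self par.Umax_pos.ne', one_smul]
  · rw [max_eq_right (not_le.1 h).le]

/-- The two `min` values are treated as independent variables. The law is smooth in all variables
together, and composing with the Lipschitz `min` terms gives `lipAt_Unom`. -/
theorem contDiffAt_unom_aux (par : Params) (Xd : State) {y : (State × ℝ) × (ℝ × ℝ)}
    (hy : y.1.1 ∈ Regular) :
    ContDiffAt ℝ 1 (fun y : (State × ℝ) × (ℝ × ℝ) =>
      (WithLp.toLp 2 (-((G par y.1.1 y.1.2).transpose.mulVec
        (par.P.mulVec (y.1.1 - Xd).ofLp +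
          (y.2.1 • ![par.q₁ * (1 - y.1.1 1), -(par.q₁ * y.1.1 0), 0, 0, 0] +
            y.2.2 • ![0, par.q₂, 0, 0, 0])))) : Control)) y := by
  rw [contDiffAt_euclidean]
  intro i
  simp only [Matrix.mulVec, dotProduct, Pi.neg_apply]
  refine (ContDiffAt.sum fun j _ => ?_).neg
  refine ContDiffAt.mul ((contDiffAt_G par hy j i).comp y contDiffAt_fst) ?_
  simp only [Pi.add_apply, Pi.smul_apply, smul_eq_mul, Matrix.mulVec, dotProduct]
  refine ContDiffAt.add (ContDiffAt.sum fun k _ => ?_) ?_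
  · simp only [PiLp.sub_apply]
    fun_prop
  · fin_cases j <;> simp <;> fun_prop

theorem lipschitzWith_min_zero : LipschitzWith 1 fun x : ℝ => min x 0 := by
  simpa using LipschitzWith.id.min_const (0 : ℝ)

theorem lipAt_Unom (par : Params) (Xd : State) {z : State × ℝ} (hz : z.1 ∈ Regular) :
    LipAt (fun z : State × ℝ => Unom par Xd z.1 z.2) z := by
  have c1 : ContDiffAt ℝ 1
      (fun z : State × ℝ => z.1 0 * (1 - z.1 1) - par.rmin - par.ε₁) z := by fun_prop
  have c2 : ContDiffAt ℝ 1 (fun z : State × ℝ => z.1 1 - par.emin - par.ε₂) z := by fun_prop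
  have h1 := (lipAt_of_lipschitzWith lipschitzWith_min_zero _).comp (lipAt_of_contDiffAt c1)
  have h2 := (lipAt_of_lipschitzWith lipschitzWith_min_zero _).comp (lipAt_of_contDiffAt c2)
  have h3 := (lipAt_of_lipschitzWith LipschitzWith.id z).prodMk (h1.prodMk h2)
  have h4 := LipAt.comp (lipAt_of_contDiffAt (contDiffAt_unom_aux par Xd (by exact hz))) h3
  refine h4.congr (Eventually.of_forall fun y => ?_)
  simp only [Unom, gradB₁_eq, gradB₂_eq, id]

theorem lipAt_Usat (par : Params) (Xd : State) {z : State × ℝ} (hz : z.1 ∈ Regular) :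
    LipAt (fun z : State × ℝ => Usat par Xd z.1 z.2) z := by
  have hu := lipAt_Unom par Xd hz
  have hn : LipAt (fun u : Control => (max par.Umax ‖u‖, u)) (Unom par Xd z.1 z.2) :=
    (lipAt_of_lipschitzWith (lipschitzWith_one_norm.const_max par.Umax) _).prodMk
      (lipAt_of_lipschitzWith LipschitzWith.id _)
  have hs : ContDiffAt ℝ 1 (fun y : ℝ × Control => (par.Umax / y.1) • y.2)
      (max par.Umax ‖Unom par Xd z.1 z.2‖, Unom par Xd z.1 z.2) :=
    (contDiffAt_const.div contDiffAt_fst (lt_max_of_lt_left par.Umax_pos).ne').fun_smul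
      contDiffAt_snd
  have := LipAt.comp (f := fun z : State × ℝ => Unom par Xd z.1 z.2)
    (LipAt.comp (f := fun u : Control => (max par.Umax ‖u‖, u)) (lipAt_of_contDiffAt hs) hn) hu
  exact this.congr (Eventually.of_forall fun y => Usat_eq par Xd y.1 y.2)

/-! ### Trajectories -/

/-- The region of non-singular states and arbitrary true anomaly. -/
def RegularPhase : Set (State × ℝ) := {z | z.1 ∈ Regular}

theorem isTrajectory_iff {par : Params} {u : State → ℝ → Control} {x : ℝ → State} {ϑ : ℝ → ℝ}
    {s : Set ℝ} :
    IsTrajectory par u x ϑ s ↔ SolvesOn (loopField par u) RegularPhase (fun t => (x t, ϑ t)) s := by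
  constructor
  · intro h t ht
    obtain ⟨h1, h2, h3⟩ := h t ht
    exact ⟨h1, h2.prodMk h3⟩
  · intro h t ht
    obtain ⟨h1, h2⟩ := h t ht
    exact ⟨h1, h2.fst, h2.snd⟩

theorem lipAt_satLoop (par : Params) (Xd : State) :
    ∀ y ∈ RegularPhase, LipAt (loopField par (Usat par Xd)) y :=
  fun _ hy => lipAt_loopField par hy (lipAt_Usat par Xd hy)

/-! ### Periodicity in the true anomaly -/

theorem G_add_int_mul_two_pi (par : Params) (X : State) (θ : ℝ) (k : ℤ) :
    G par X (θ + k * (2 * Real.pi)) = G par X θ := by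
  simp only [G, eccAnomaly, radius, Real.cos_add_int_mul_two_pi, Real.sin_add_int_mul_two_pi,
    add_right_comm θ _ (X 4)]

theorem anomalyRate_add_int_mul_two_pi (par : Params) (X : State) (θ : ℝ) (U : Control) (k : ℤ) :
    anomalyRate par X (θ + k * (2 * Real.pi)) U = anomalyRate par X θ U := by
  simp only [anomalyRate, radius, Real.cos_add_int_mul_two_pi, Real.sin_add_int_mul_two_pi]

theorem Unom_add_int_mul_two_pi (par : Params) (Xd X : State) (θ : ℝ) (k : ℤ) :
    Unom par Xd X (θ + k * (2 * Real.pi)) = Unom par Xd X θ := by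
  simp only [Unom, G_add_int_mul_two_pi]

theorem Usat_add_int_mul_two_pi (par : Params) (Xd X : State) (θ : ℝ) (k : ℤ) :
    Usat par Xd X (θ + k * (2 * Real.pi)) = Usat par Xd X θ := by
  simp only [Usat, Unom_add_int_mul_two_pi]

theorem IsTrajectory.add_int_mul_two_pi {par : Params} {Xd : State} {x : ℝ → State} {ϑ : ℝ → ℝ}
    {s : Set ℝ} (h : IsTrajectory par (Usat par Xd) x ϑ s) (k : ℤ) :
    IsTrajectory par (Usat par Xd) x (fun t => ϑ t + k * (2 * Real.pi)) s := by
  intro t ht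
  obtain ⟨h1, h2, h3⟩ := h t ht
  simp only [Usat_add_int_mul_two_pi, G_add_int_mul_two_pi, anomalyRate_add_int_mul_two_pi]
  exact ⟨h1, h2, h3.add_const _⟩

theorem TerminalCond.add_int_mul_two_pi {par : Params} {c₀ : State → ℝ} {thor t : ℝ} {X : State}
    {θ : ℝ} {Xd : State} (h : TerminalCond par c₀ thor t X θ Xd) (k : ℤ) :
    TerminalCond par c₀ thor t X (θ + k * (2 * Real.pi)) Xd := by
  obtain ⟨Y, hY, x, ϑ, hx, h1, h2, h3⟩ := h
  exact ⟨Y, hY, x, _, hx.add_int_mul_two_pi k, h1, by simp [h2], h3⟩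

theorem exists_eq_add_int_mul_two_pi (θ : ℝ) :
    ∃ θ' ∈ Ico 0 (2 * Real.pi), ∃ k : ℤ, θ = θ' + k * (2 * Real.pi) := by
  refine ⟨toIcoMod Real.two_pi_pos 0 θ, ?_, toIcoDiv Real.two_pi_pos 0 θ, ?_⟩
  · simpa using toIcoMod_mem_Ico Real.two_pi_pos 0 θ
  · rw [← zsmul_eq_mul, toIcoMod_add_toIcoDiv_zsmul]

/-- (A2) speaks only of `θ ∈ [0, 2π)`, while the anomaly along a trajectory is any real number.
Periodicity of the equations removes the restriction. -/
theorem A2.terminalCond {par : Params} {c₀ : State → ℝ} {thor : ℝ} {𝒯 : Set State} {ε : ℝ}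
    (h : A2 par c₀ thor 𝒯 ε) {Xd Xd' : State} (hXd : Xd ∈ 𝒯) (hXd' : Xd' ∈ 𝒯)
    (hε : ‖Xd' - Xd‖ ≤ ε) {X : State} (hX : X ∈ Q par c₀ Xd) (t θ : ℝ) :
    TerminalCond par c₀ thor t X θ Xd' := by
  obtain ⟨θ', hθ', k, rfl⟩ := exists_eq_add_int_mul_two_pi θ
  have := h Xd hXd t X hX θ' hθ' (Xd' - Xd) hε (by simpa using hXd')
  rw [add_sub_cancel] at this
  exact this.add_int_mul_two_pi k

theorem A3.norm_Unom_le {par : Params} {c₀ : State → ℝ} {Xdes : State} (h : A3 par c₀ Xdes)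
    {X : State} (hX : X ∈ Q par c₀ Xdes) (θ : ℝ) : ‖Unom par Xdes X θ‖ ≤ par.Umax := by
  obtain ⟨θ', hθ', k, rfl⟩ := exists_eq_add_int_mul_two_pi θ
  rw [Unom_add_int_mul_two_pi]
  exact h X hX θ' hθ'

/-! ### The Lyapunov function decreases along the closed loop -/

theorem hasDerivWithinAt_coord {x : ℝ → State} {v : State} {s : Set ℝ} {t : ℝ}
    (h : HasDerivWithinAt x v s t) (i : Fin 5) :
    HasDerivWithinAt (fun τ => x τ i) (v i) s t :=
  (EuclideanSpace.proj (𝕜 := ℝ) i).hasFDerivAt.comp_hasDerivWithinAt t h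

theorem hasDerivWithinAt_V₀ {P : Matrix (Fin 5) (Fin 5) ℝ} (hP : P.IsSymm) {x : ℝ → State}
    {v : State} {s : Set ℝ} {t : ℝ} (h : HasDerivWithinAt x v s t) (Xd : State) :
    HasDerivWithinAt (fun τ => V₀ P (x τ) Xd) (P.mulVec (x t - Xd).ofLp ⬝ᵥ v.ofLp) s t := by
  have hy : ∀ i, HasDerivWithinAt (fun τ => (x τ - Xd).ofLp i) (v i) s t := fun i => by
    simpa using (hasDerivWithinAt_coord h i).sub_const (Xd i)
  have hPy : ∀ i, HasDerivWithinAt (fun τ => P.mulVec (x τ - Xd).ofLp i) (P.mulVec v.ofLp i) s t :=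
    fun i => by
      simp only [Matrix.mulVec, dotProduct]
      exact HasDerivWithinAt.fun_sum fun j _ => (hy j).const_mul _
  have hsum : HasDerivWithinAt (fun τ => V₀ P (x τ) Xd)
      (1 / 2 * ∑ i, (v i * P.mulVec (x t - Xd).ofLp i + (x t - Xd).ofLp i * P.mulVec v.ofLp i))
      s t := by
    simp only [V₀, dotProduct]
    exact (HasDerivWithinAt.fun_sum fun i _ => (hy i).mul (hPy i)).const_mul _
  convert hsum using 1
  rw [Finset.sum_add_distrib]
  change _ = 1 / 2 * (v.ofLp ⬝ᵥ P.mulVec (x t - Xd).ofLp + (x t - Xd).ofLp ⬝ᵥ P.mulVec v.ofLp)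
  rw [Matrix.dotProduct_mulVec (x t - Xd).ofLp, ← Matrix.mulVec_transpose, hP.eq,
    dotProduct_comm v.ofLp]
  ring

/-- Squaring removes the kink of `min · 0`: at `0` the function is bounded by `y²`, so its
derivative vanishes there. Hence the barriers are differentiable across their thresholds. -/
theorem hasDerivAt_min_zero_sq (y : ℝ) :
    HasDerivAt (fun y : ℝ => min y 0 ^ 2) (2 * min y 0) y := by
  rcases lt_trichotomy y 0 with h | rfl | h
  · have h1 : HasDerivAt (fun y : ℝ => y ^ 2) (2 * y) y := by simpa using hasDerivAt_pow 2 y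
    rw [min_eq_left h.le]
    refine h1.congr_of_eventuallyEq ?_
    filter_upwards [Iio_mem_nhds h] with w hw
    rw [min_eq_left (mem_Iio.1 hw).le]
  · have : (fun y : ℝ => min y 0 ^ 2) =O[𝓝 0] fun y : ℝ => ‖y - 0‖ ^ 2 := by
      refine Asymptotics.IsBigO.of_bound 1 (Eventually.of_forall fun w => ?_)
      simp only [sub_zero, norm_pow, one_mul, Real.norm_eq_abs]
      gcongr 1
      rcases le_total w 0 with hw | hw <;> simp [hw]
    simpa [hasDerivAt_iff_hasFDerivAt] using! this.hasFDerivAt (𝕜 := ℝ) one_lt_two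
  · rw [min_eq_right h.le, mul_zero]
    refine (hasDerivAt_const y (0 : ℝ)).congr_of_eventuallyEq ?_
    filter_upwards [Ioi_mem_nhds h] with w hw
    simp [min_eq_right (mem_Ioi.1 hw).le]

theorem B₁_eq (par : Params) (X : State) :
    B₁ par X = 1 / 2 * par.q₁ * min (X 0 * (1 - X 1) - par.rmin - par.ε₁) 0 ^ 2 := by
  unfold B₁
  split_ifs with h
  · rw [min_eq_left (by linarith)]
  · rw [min_eq_right (by linarith)]; simp

theorem B₂_eq (par : Params) (X : State) :
    B₂ par X = 1 / 2 * par.q₂ * min (X 1 - par.emin - par.ε₂) 0 ^ 2 := by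
  unfold B₂
  split_ifs with h
  · rw [min_eq_left (by linarith)]
  · rw [min_eq_right (by linarith)]; simp

theorem B₁_nonneg (par : Params) (X : State) : 0 ≤ B₁ par X := by
  have := par.q₁_pos
  rw [B₁_eq]; positivity

theorem B₂_nonneg (par : Params) (X : State) : 0 ≤ B₂ par X := by
  have := par.q₂_pos
  rw [B₂_eq]; positivity

theorem gradB₁_eq_zero {par : Params} {X : State} (h : B₁ par X = 0) : gradB₁ par X = 0 := by
  rw [B₁_eq] at h
  have := par.q₁_pos.ne'
  have h0 : min (X 0 * (1 - X 1) - par.rmin - par.ε₁) 0 = 0 := by simpa [this] using h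
  rw [gradB₁_eq, h0, zero_smul]

theorem gradB₂_eq_zero {par : Params} {X : State} (h : B₂ par X = 0) : gradB₂ par X = 0 := by
  rw [B₂_eq] at h
  have := par.q₂_pos.ne'
  have h0 : min (X 1 - par.emin - par.ε₂) 0 = 0 := by simpa [this] using h
  rw [gradB₂_eq, h0, zero_smul]

theorem hasDerivWithinAt_B₁ (par : Params) {x : ℝ → State} {v : State} {s : Set ℝ} {t : ℝ}
    (h : HasDerivWithinAt x v s t) :
    HasDerivWithinAt (fun τ => B₁ par (x τ)) (gradB₁ par (x t) ⬝ᵥ v.ofLp) s t := by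
  have h0 := hasDerivWithinAt_coord h 0
  have h1 := hasDerivWithinAt_coord h 1
  have hφ := ((h0.mul (h1.const_sub 1)).sub_const par.rmin).sub_const par.ε₁
  have := ((hasDerivAt_min_zero_sq _).comp_hasDerivWithinAt t hφ).const_mul (1 / 2 * par.q₁)
  simp only [B₁_eq]
  refine this.congr_deriv ?_
  rw [gradB₁_eq]
  simp [dotProduct, Fin.sum_univ_five]
  ring

theorem hasDerivWithinAt_B₂ (par : Params) {x : ℝ → State} {v : State} {s : Set ℝ} {t : ℝ}
    (h : HasDerivWithinAt x v s t) :
    HasDerivWithinAt (fun τ => B₂ par (x τ)) (gradB₂ par (x t) ⬝ᵥ v.ofLp) s t := by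
  have hφ := ((hasDerivWithinAt_coord h 1).sub_const par.emin).sub_const par.ε₂
  have := ((hasDerivAt_min_zero_sq _).comp_hasDerivWithinAt t hφ).const_mul (1 / 2 * par.q₂)
  simp only [B₂_eq]
  refine this.congr_deriv ?_
  rw [gradB₂_eq]
  simp [dotProduct, Fin.sum_univ_five]
  ring

theorem Params.P_isSymm (par : Params) : par.P.IsSymm := by
  have := par.P_posDef.isHermitian
  rwa [Matrix.IsHermitian, Matrix.conjTranspose_eq_transpose_of_trivial] at this

theorem dotProduct_mulVec_neg_transpose_mulVec (M : Matrix (Fin 5) (Fin 3) ℝ) (w : Fin 5 → ℝ) :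
    w ⬝ᵥ M.mulVec (-(M.transpose.mulVec w)) =
      -(M.transpose.mulVec w ⬝ᵥ M.transpose.mulVec w) := by
  rw [Matrix.dotProduct_mulVec, ← Matrix.mulVec_transpose, dotProduct_neg]

/-- The total Lyapunov function `V₀ + B₁ + B₂` does not increase along the closed loop. -/
theorem antitoneOn_lyapunov {par : Params} {Xd : State} {x : ℝ → State} {ϑ : ℝ → ℝ} {s s' : ℝ}
    (h : IsTrajectory par (Usat par Xd) x ϑ (Icc s s')) :
    AntitoneOn (fun τ => V₀ par.P (x τ) Xd + (B₁ par (x τ) + B₂ par (x τ))) (Icc s s') := by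
  have hd := fun τ (hτ : τ ∈ Icc s s') =>
    (hasDerivWithinAt_V₀ par.P_isSymm (h τ hτ).2.1 Xd).fun_add
      ((hasDerivWithinAt_B₁ par (h τ hτ).2.1).fun_add (hasDerivWithinAt_B₂ par (h τ hτ).2.1))
  refine antitoneOn_of_hasDerivWithinAt_nonpos (convex_Icc s s')
    (fun τ hτ => (hd τ hτ).continuousWithinAt)
    (fun τ hτ => (hd τ (interior_subset hτ)).mono interior_subset) fun τ _ => ?_
  simp only [← add_dotProduct]
  -- Saturation only rescales `U_nom = -Gᵀ w` by a nonnegative factor, with `w` the gradient of the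
  -- total Lyapunov function; the derivative is that factor times `-|Gᵀ w|²`.
  rw [Usat_eq]
  simp only [Unom, WithLp.ofLp_smul, Matrix.mulVec_smul, dotProduct_smul,
    dotProduct_mulVec_neg_transpose_mulVec, smul_eq_mul]
  have hU := par.Umax_pos
  refine mul_nonpos_of_nonneg_of_nonpos ?_ (neg_nonpos.2 (by
    rw [dotProduct]; exact Finset.sum_nonneg fun i _ => mul_self_nonneg _))
  exact div_nonneg hU.le (le_max_of_le_left hU.le)

/-- Sublevel sets of `V₀` are left by no solution that starts where the barriers vanish. -/
theorem IsTrajectory.V₀_le {par : Params} {Xd : State} {x : ℝ → State} {ϑ : ℝ → ℝ} {s s' : ℝ}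
    (h : IsTrajectory par (Usat par Xd) x ϑ (Icc s s')) (h₁ : B₁ par (x s) = 0)
    (h₂ : B₂ par (x s) = 0) {τ : ℝ} (hτ : τ ∈ Icc s s') :
    V₀ par.P (x τ) Xd ≤ V₀ par.P (x s) Xd := by
  have := antitoneOn_lyapunov h ⟨le_rfl, hτ.1.trans hτ.2⟩ hτ hτ.1
  simp only [h₁, h₂, add_zero] at this
  linarith [B₁_nonneg par (x τ), B₂_nonneg par (x τ)]

/-! ### The initial state as virtual target -/

theorem Usat_self {par : Params} {X : State} (h₁ : B₁ par X = 0) (h₂ : B₂ par X = 0) (θ : ℝ) :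
    Usat par X X θ = 0 := by
  have : Unom par X X θ = 0 := by
    simp [Unom, gradB₁_eq_zero h₁, gradB₂_eq_zero h₂]
  rw [Usat_eq, this, smul_zero]

theorem anomalyRate_zero {par : Params} {X : State} (θ : ℝ) :
    anomalyRate par X θ 0 =
      angMom par X / semiLatus X ^ 2 * (1 + X 1 * Real.cos θ) ^ 2 := by
  simp [anomalyRate, radius, div_pow]
  field_simp

/-- Without thrust the orbital elements are constant, and `θ` obeys a scalar autonomous equation
with bounded Lipschitz right-hand side. -/
theorem exists_kepler_motion (par : Params) {X : State} (hX : X ∈ Regular) {s s' : ℝ}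
    (hs : s ≤ s') (θ₀ : ℝ) :
    ∃ ϑ : ℝ → ℝ, ϑ s = θ₀ ∧
      ∀ t ∈ Icc s s', HasDerivWithinAt ϑ (anomalyRate par X (ϑ t) 0) (Icc s s') t := by
  set C := angMom par X / semiLatus X ^ 2
  have hC : 0 ≤ C := div_nonneg (angMom_pos par hX).le (sq_nonneg _)
  have e0 := hX.2.1
  have e1 := hX.2.2.1
  have hb : ∀ θ : ℝ, |1 + X 1 * Real.cos θ| ≤ 2 := fun θ => by
    rw [abs_le]
    constructor <;> nlinarith [Real.neg_one_le_cos θ, Real.cos_le_one θ]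
  have hd : ∀ θ : ℝ, HasDerivAt (fun θ => C * (1 + X 1 * Real.cos θ) ^ 2)
      (C * (2 * (1 + X 1 * Real.cos θ) * (X 1 * -Real.sin θ))) θ := fun θ => by
    simpa using (((Real.hasDerivAt_cos θ).const_mul (X 1)).const_add 1).pow 2 |>.const_mul C
  -- The factor `4` comes from `|2 (1 + e cos θ) e sin θ| ≤ 2 · 2 · 1`.
  have hlip : LipschitzWith (C * 4).toNNReal fun θ => C * (1 + X 1 * Real.cos θ) ^ 2 := by
    refine lipschitzWith_of_nnnorm_deriv_le (fun θ => (hd θ).differentiableAt) fun θ => ?_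
    rw [(hd θ).deriv, ← NNReal.coe_le_coe, coe_nnnorm,
      Real.coe_toNNReal _ (by positivity)]
    rw [Real.norm_eq_abs, abs_mul, abs_of_nonneg hC, abs_mul, abs_mul, abs_mul, abs_neg,
      abs_of_pos e0, abs_two]
    have h1 : X 1 * |Real.sin θ| ≤ 1 := by
      nlinarith [Real.abs_sin_le_one θ, abs_nonneg (Real.sin θ)]
    have h2 : 0 ≤ X 1 * |Real.sin θ| := by positivity
    refine mul_le_mul_of_nonneg_left ?_ hC
    nlinarith [hb θ, abs_nonneg (1 + X 1 * Real.cos θ)]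
  have hbd : ∀ θ : ℝ, ‖C * (1 + X 1 * Real.cos θ) ^ 2‖ ≤ C * 4 := fun θ => by
    rw [Real.norm_eq_abs, abs_mul, abs_of_nonneg hC, abs_pow]
    refine mul_le_mul_of_nonneg_left ?_ hC
    nlinarith [hb θ, abs_nonneg (1 + X 1 * Real.cos θ)]
  obtain ⟨ϑ, h0, hϑ⟩ := exists_solution_of_lipschitz_of_bounded hlip hbd hs θ₀
  exact ⟨ϑ, h0, fun t ht => by rw [anomalyRate_zero]; exact hϑ t ht⟩

theorem terminalCond_self {par : Params} {c₀ : State → ℝ} {thor : ℝ} (hthor : 0 < thor)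
    {X : State} (hX : X ∈ Regular) (h₁ : B₁ par X = 0) (h₂ : B₂ par X = 0) (hc : 0 < c₀ X)
    (s θ₀ : ℝ) : TerminalCond par c₀ thor s X θ₀ X := by
  obtain ⟨ϑ, h0, hϑ⟩ := exists_kepler_motion par hX (show s ≤ s + thor by linarith) θ₀
  refine ⟨X, by simpa [Q, V₀] using hc.le, fun _ => X, ϑ, fun t ht => ⟨hX, ?_, ?_⟩, rfl, h0, rfl⟩
  · rw [Usat_self h₁ h₂]
    simpa using hasDerivWithinAt_const t (Icc s (s + thor)) X
  · rw [Usat_self h₁ h₂]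
    exact hϑ t ht

/-! ### Estimates in the supremum norm -/

section SupNorm

variable {m n : Type*} [Fintype m] [Fintype n]

/-- The norm on functions is the supremum norm, hence the dimension factor: `3 * M` for `Γ` and `5 *
M` for its transpose below. -/
theorem norm_mulVec_le {A : Matrix m n ℝ} {M : ℝ} (hM0 : 0 ≤ M) (hM : ∀ i j, |A i j| ≤ M)
    (y : n → ℝ) : ‖A.mulVec y‖ ≤ Fintype.card n * M * ‖y‖ := by
  refine (pi_norm_le_iff_of_nonneg (by positivity)).2 fun i => ?_
  rw [Matrix.mulVec, dotProduct]
  refine (norm_sum_le _ _).trans ?_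
  calc ∑ j, ‖A i j * y j‖ ≤ ∑ _j : n, M * ‖y‖ := by
        refine Finset.sum_le_sum fun j _ => ?_
        rw [norm_mul]
        exact mul_le_mul (hM i j) (norm_le_pi_norm y j) (norm_nonneg _) hM0
    _ = Fintype.card n * M * ‖y‖ := by simp [mul_assoc]

theorem zero_le_dotProduct_self (y : n → ℝ) : 0 ≤ y ⬝ᵥ y :=
  Finset.sum_nonneg fun _ _ => mul_self_nonneg _

theorem norm_sq_le_dotProduct_self (y : n → ℝ) : ‖y‖ ^ 2 ≤ y ⬝ᵥ y := by
  have h : ‖y‖ ≤ Real.sqrt (y ⬝ᵥ y) := by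
    refine (pi_norm_le_iff_of_nonneg (Real.sqrt_nonneg _)).2 fun i => ?_
    refine Real.le_sqrt_of_sq_le ?_
    rw [Real.norm_eq_abs, sq_abs, sq]
    exact Finset.single_le_sum (f := fun i => y i * y i) (fun _ _ => mul_self_nonneg _)
      (Finset.mem_univ i)
  calc ‖y‖ ^ 2 ≤ Real.sqrt (y ⬝ᵥ y) ^ 2 := by gcongr
    _ = _ := Real.sq_sqrt (zero_le_dotProduct_self y)

theorem dotProduct_self_le (y : n → ℝ) : y ⬝ᵥ y ≤ Fintype.card n * ‖y‖ ^ 2 := by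
  calc y ⬝ᵥ y ≤ ∑ _j : n, ‖y‖ ^ 2 := by
        refine Finset.sum_le_sum fun j _ => ?_
        rw [← sq, ← sq_abs]
        have := norm_le_pi_norm y j
        rw [Real.norm_eq_abs] at this
        gcongr
    _ = _ := by simp

theorem dotProduct_self_le_two_mul (u v : n → ℝ) :
    u ⬝ᵥ u ≤ 2 * (v ⬝ᵥ v) + 2 * ((u - v) ⬝ᵥ (u - v)) := by
  simp only [dotProduct, Finset.mul_sum, ← Finset.sum_add_distrib]
  refine Finset.sum_le_sum fun j _ => ?_
  simp only [Pi.sub_apply]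
  nlinarith [sq_nonneg (u j - 2 * v j)]

theorem exists_norm_mulVec_le (A : Matrix m n ℝ) : ∃ C, 0 ≤ C ∧ ∀ y, ‖A.mulVec y‖ ≤ C * ‖y‖ := by
  classical
  exact ⟨_, norm_nonneg _, fun y => A.mulVecLin.toContinuousLinearMap.le_opNorm y⟩

end SupNorm

/-! ### Error equations under persistent excitation -/

/-- The matrix inequality is tested on a constant vector, which then passes inside the entrywise
integrals. -/
theorem mul_dotProduct_le_integral {Γ : ℝ → Matrix (Fin 5) (Fin 3) ℝ} {t T α : ℝ}
    (hT : 0 < T)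
    (hPE : ((Matrix.of fun i j => ∫ τ in t..(t + T), (Γ τ * (Γ τ).transpose) i j)
      - α • (1 : Matrix (Fin 5) (Fin 5) ℝ)).PosSemidef)
    (hΓ : ∀ i j, ContinuousOn (fun τ => Γ τ i j) (Icc t (t + T))) (w : Fin 5 → ℝ) :
    α * (w ⬝ᵥ w) ≤
      ∫ τ in t..(t + T), (Γ τ).transpose.mulVec w ⬝ᵥ (Γ τ).transpose.mulVec w := by
  have h := hPE.dotProduct_mulVec_nonneg w
  rw [star_trivial, Matrix.sub_mulVec, dotProduct_sub, Matrix.smul_mulVec, Matrix.one_mulVec,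
    dotProduct_smul, smul_eq_mul, sub_nonneg] at h
  refine h.trans (le_of_eq ?_)
  have hc : ∀ i j, IntervalIntegrable (fun τ => (Γ τ * (Γ τ).transpose) i j)
      MeasureTheory.volume t (t + T) := fun i j => by
    refine ContinuousOn.intervalIntegrable_of_Icc (by linarith) ?_
    simp only [Matrix.mul_apply, Matrix.transpose_apply]
    exact continuousOn_finsetSum _ fun k _ => (hΓ i k).mul (hΓ j k)
  have hc' : ∀ i, IntervalIntegrable (fun τ => ∑ j, (w i * w j) * (Γ τ * (Γ τ).transpose) i j)
      MeasureTheory.volume t (t + T) := fun i => by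
    simpa only [Finset.sum_fn] using
      IntervalIntegrable.sum Finset.univ fun j _ => (hc i j).const_mul (w i * w j)
  have hpt : ∀ τ, (Γ τ).transpose.mulVec w ⬝ᵥ (Γ τ).transpose.mulVec w =
      ∑ i, ∑ j, (w i * w j) * (Γ τ * (Γ τ).transpose) i j := fun τ => by
    rw [Matrix.dotProduct_mulVec, Matrix.vecMul_transpose, Matrix.mulVec_mulVec, dotProduct_comm]
    simp only [dotProduct, Matrix.mulVec, Finset.mul_sum]
    exact Finset.sum_congr rfl fun i _ => Finset.sum_congr rfl fun j _ => by ring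
  simp only [hpt]
  rw [intervalIntegral.integral_finsetSum fun i _ => hc' i]
  simp only [dotProduct, Matrix.mulVec, Matrix.of_apply, Finset.mul_sum]
  refine Finset.sum_congr rfl fun i _ => ?_
  rw [intervalIntegral.integral_finsetSum fun j _ => (hc i j).const_mul _]
  refine Finset.sum_congr rfl fun j _ => ?_
  rw [intervalIntegral.integral_const_mul]
  ring

section ErrorEquation

variable {P : Matrix (Fin 5) (Fin 5) ℝ} {x : ℝ → State} {xd : State}
  {Γ : ℝ → Matrix (Fin 5) (Fin 3) ℝ} {t₁ : ℝ}

/-- The output `Γᵀ P (x - xd)` of the error equation. -/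
noncomputable def excitation (P : Matrix (Fin 5) (Fin 5) ℝ) (x : ℝ → State) (xd : State)
    (Γ : ℝ → Matrix (Fin 5) (Fin 3) ℝ) (t : ℝ) : Fin 3 → ℝ :=
  (Γ t).transpose.mulVec (P.mulVec (x t - xd).ofLp)

theorem hasDerivWithinAt_V₀_errorEquation (hP : P.IsSymm) {s : Set ℝ} {t : ℝ}
    (hx : HasDerivWithinAt x (WithLp.toLp 2 ((Γ t).mulVec (-excitation P x xd Γ t))) s t) :
    HasDerivWithinAt (fun τ => V₀ P (x τ) xd)
      (-(excitation P x xd Γ t ⬝ᵥ excitation P x xd Γ t)) s t := by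
  refine (hasDerivWithinAt_V₀ hP hx xd).congr_deriv ?_
  exact dotProduct_mulVec_neg_transpose_mulVec _ _

theorem continuousOn_excitation {s : Set ℝ} (hx : ContinuousOn x s)
    (hΓ : ∀ i j, ContinuousOn (fun τ => Γ τ i j) s) (j : Fin 3) :
    ContinuousOn (fun τ => excitation P x xd Γ τ j) s := by
  simp only [excitation, Matrix.mulVec, dotProduct, Matrix.transpose_apply, PiLp.sub_apply]
  refine continuousOn_finsetSum _ fun i _ => (hΓ i j).mul ?_
  refine continuousOn_finsetSum _ fun k _ => continuousOn_const.mul ?_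
  exact ((EuclideanSpace.proj (𝕜 := ℝ) k).continuous.comp_continuousOn hx).sub continuousOn_const

theorem V₀_nonneg (hP : P.PosDef) (X Xd : State) : 0 ≤ V₀ P X Xd := by
  have := hP.posSemidef.dotProduct_mulVec_nonneg (X - Xd).ofLp
  rw [star_trivial] at this
  unfold V₀
  linarith

/-- Displacement of the state of the error equation in terms of the decrease of `V₀`. -/
theorem norm_sub_le_of_errorEquation (hP : P.IsSymm)
    (hx : ∀ t ∈ Ici t₁,
      HasDerivWithinAt x (WithLp.toLp 2 ((Γ t).mulVec (-excitation P x xd Γ t))) (Ici t₁) t)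
    {M : ℝ} (hM0 : 0 ≤ M) (hM : ∀ t ∈ Ici t₁, ∀ i j, |Γ t i j| ≤ M) {t τ η : ℝ} (ht : t₁ ≤ t)
    (hτ : t ≤ τ) (hη : 0 < η) :
    ‖(x τ).ofLp - (x t).ofLp‖ ≤
      3 * M * ((V₀ P (x t) xd - V₀ P (x τ) xd) / (2 * η) + η / 2 * (τ - t)) := by
  have hV := fun s (hs : s ∈ Ici t₁) => hasDerivWithinAt_V₀_errorEquation (xd := xd) hP (hx s hs)
  have hsub : Icc t τ ⊆ Ici t₁ := fun s hs => ht.trans hs.1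
  have hsub' : ∀ s ∈ Ico t τ, Ici s ⊆ Ici t₁ := fun s hs => Ici_subset_Ici.2 (ht.trans hs.1)
  have hz : ∀ s ∈ Ici t₁, HasDerivWithinAt (fun s => (x s).ofLp - (x t).ofLp)
      ((Γ s).mulVec (-excitation P x xd Γ s)) (Ici t₁) s := fun s hs =>
    hasDerivWithinAt_pi.2 fun i => (hasDerivWithinAt_coord (hx s hs) i).sub_const _
  have hB : ∀ s ∈ Ici t₁, HasDerivWithinAt
      (fun s => 3 * M * ((V₀ P (x t) xd - V₀ P (x s) xd) / (2 * η) + η / 2 * (s - t)))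
      (3 * M * ((excitation P x xd Γ s ⬝ᵥ excitation P x xd Γ s) / (2 * η) + η / 2))
      (Ici t₁) s := fun s hs => by
    have h1 := ((hV s hs).const_sub (V₀ P (x t) xd)).div_const (2 * η)
    have h2 := (((hasDerivAt_id s).sub_const t).const_mul (η / 2)).hasDerivWithinAt (s := Ici t₁)
    refine ((h1.add h2).const_mul (3 * M)).congr_deriv ?_
    simp
  -- Comparing derivatives replaces Cauchy–Schwarz under the integral: since `V₀' = -|g|²`, the
  -- majorant grows at rate `3 M (|g|² / (2 η) + η / 2)`.
  refine image_norm_le_of_norm_deriv_right_le_deriv_boundary' (a := t) (b := τ)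
    (f := fun s => (x s).ofLp - (x t).ofLp)
    (fun s hs => (hz s (hsub hs)).continuousWithinAt.mono hsub)
    (fun s hs => (hz s (hsub (Ico_subset_Icc_self hs))).mono (hsub' s hs)) (by simp)
    (fun s hs => (hB s (hsub hs)).continuousWithinAt.mono hsub)
    (fun s hs => (hB s (hsub (Ico_subset_Icc_self hs))).mono (hsub' s hs)) (fun s hs => ?_)
    ⟨hτ, le_rfl⟩
  refine (norm_mulVec_le hM0 (hM s (hsub (Ico_subset_Icc_self hs))) _).trans ?_
  rw [norm_neg, Fintype.card_fin]
  push_cast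
  refine mul_le_mul_of_nonneg_left ?_ (by positivity)
  set g := excitation P x xd Γ s
  have h1 := norm_sq_le_dotProduct_self g
  -- Young's inequality, with `η` left free for balancing the two terms later.
  have h2 : ‖g‖ ≤ ‖g‖ ^ 2 / (2 * η) + η / 2 := by
    have : ‖g‖ ^ 2 / (2 * η) + η / 2 - ‖g‖ = (‖g‖ - η) ^ 2 / (2 * η) := by
      field_simp
      ring
    have : 0 ≤ (‖g‖ - η) ^ 2 / (2 * η) := by positivity
    linarith
  refine h2.trans ?_
  gcongr

/-- Under persistent excitation, at any real level `α > 0`, the solutions of the error equation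
`x' = -Γ Γᵀ P (x - xd)` converge to `xd`. -/
theorem tendsto_of_excitation (hP : P.PosDef) (hPs : P.IsSymm)
    (hx : ∀ t ∈ Ici t₁,
      HasDerivWithinAt x (WithLp.toLp 2 ((Γ t).mulVec (-excitation P x xd Γ t))) (Ici t₁) t)
    (hΓ : ∀ i j, ContinuousOn (fun τ => Γ τ i j) (Ici t₁))
    {M : ℝ} (hM0 : 0 ≤ M) (hM : ∀ t ∈ Ici t₁, ∀ i j, |Γ t i j| ≤ M)
    {T α : ℝ} (hT : 0 < T) (hα : 0 < α)
    (hPE : ∀ t ≥ t₁, ((Matrix.of fun i j => ∫ τ in t..(t + T), (Γ τ * (Γ τ).transpose) i j)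
      - α • (1 : Matrix (Fin 5) (Fin 5) ℝ)).PosSemidef) : Tendsto x atTop (𝓝 xd) := by
  obtain ⟨C, hC0, hC⟩ := exists_norm_mulVec_le P
  set V : ℝ → ℝ := fun t => V₀ P (x t) xd with hVdef
  set g := excitation P x xd Γ with hg
  have hV : ∀ t ∈ Ici t₁, HasDerivWithinAt V (-(g t ⬝ᵥ g t)) (Ici t₁) t := fun t ht =>
    hasDerivWithinAt_V₀_errorEquation hPs (hx t ht)
  have hVc : ContinuousOn V (Ici t₁) := fun t ht => (hV t ht).continuousWithinAt
  have hanti : AntitoneOn V (Ici t₁) :=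
    antitoneOn_of_hasDerivWithinAt_nonpos (convex_Ici t₁) hVc
      (fun t ht => (hV t (interior_subset ht)).mono interior_subset)
      (fun t _ => neg_nonpos.2 (zero_le_dotProduct_self _))
  -- the decrease of `V` over a window of length `T` tends to zero
  have hlim : ∃ l, Tendsto V atTop (𝓝 l) := by
    have ha : Antitone fun t => V (max t₁ t) := fun s t hst =>
      hanti (mem_Ici.2 (le_max_left _ _)) (mem_Ici.2 (le_max_left _ _)) (max_le_max le_rfl hst)
    have hb : BddBelow (range fun t => V (max t₁ t)) :=
      ⟨0, by rintro _ ⟨t, rfl⟩; exact V₀_nonneg hP _ _⟩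
    refine ⟨_, (tendsto_atTop_ciInf ha hb).congr' ?_⟩
    filter_upwards [eventually_ge_atTop t₁] with t ht
    rw [max_eq_right ht]
  obtain ⟨l, hl⟩ := hlim
  have hD : Tendsto (fun t => V t - V (t + T)) atTop (𝓝 0) := by
    simpa using hl.sub (hl.comp (tendsto_atTop_add_const_right atTop T tendsto_id))
  -- The square root of the decrease balances the two terms of the displacement bound; `exp (-t)`
  -- keeps `η` positive even where `V` does not decrease.
  set η : ℝ → ℝ := fun t => Real.sqrt (V t - V (t + T) + Real.exp (-t)) with hηdef
  have hηlim : Tendsto η atTop (𝓝 0) := by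
    have := (hD.add (Real.tendsto_exp_neg_atTop_nhds_zero)).sqrt
    simpa using this
  -- the main estimate
  have key : ∀ t ≥ t₁, α * ‖P.mulVec (x t - xd).ofLp‖ ^ 2 ≤
      2 * (V t - V (t + T)) +
        T * (6 * (5 * M * (C * (3 * M * (η t / 2 + η t / 2 * T)))) ^ 2) := by
    intro t ht
    have hDnn : 0 ≤ V t - V (t + T) :=
      sub_nonneg.2 (hanti ht (show t₁ ≤ t + T by linarith) (by linarith))
    have hη : 0 < η t := Real.sqrt_pos.2 (by positivity)
    have hη2 : V t - V (t + T) ≤ η t ^ 2 := by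
      rw [hηdef, Real.sq_sqrt (by positivity)]
      linarith [Real.exp_pos (-t)]
    set w := P.mulVec (x t - xd).ofLp with hw
    have hsub : Icc t (t + T) ⊆ Ici t₁ := fun s hs => ht.trans hs.1
    have hxc : ContinuousOn x (Ici t₁) := fun s hs => (hx s hs).continuousWithinAt
    have hdisp : ∀ τ ∈ Icc t (t + T), ‖(x τ).ofLp - (x t).ofLp‖ ≤
        3 * M * (η t / 2 + η t / 2 * T) := by
      intro τ hτ
      refine (norm_sub_le_of_errorEquation hPs hx hM0 hM ht hτ.1 hη).trans ?_
      have h1 : V t - V τ ≤ η t ^ 2 := by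
        have : V (t + T) ≤ V τ := hanti (hsub hτ) (show t₁ ≤ t + T by linarith) hτ.2
        linarith
      have h2 : (V t - V τ) / (2 * η t) ≤ η t / 2 := by
        rw [div_le_iff₀ (by positivity)]
        nlinarith
      have h3 : τ - t ≤ T := by linarith [hτ.2]
      gcongr
    -- Freezing `w` at time `t` costs `Γᵀ P (x τ - x t)`. Its sup norm is at most `5 M · C` times
    -- the displacement, and `6 = 2 · 3` combines `|u|² ≤ 2|v|² + 2|u - v|²` with the passage from
    -- the sup norm on three coordinates.
    have hpt : ∀ τ ∈ Icc t (t + T),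
        (Γ τ).transpose.mulVec w ⬝ᵥ (Γ τ).transpose.mulVec w ≤ 2 * (g τ ⬝ᵥ g τ) +
          6 * (5 * M * (C * (3 * M * (η t / 2 + η t / 2 * T)))) ^ 2 := by
      intro τ hτ
      refine (dotProduct_self_le_two_mul _ (g τ)).trans ?_
      have e : (Γ τ).transpose.mulVec w - g τ =
          -(Γ τ).transpose.mulVec (P.mulVec ((x τ).ofLp - (x t).ofLp)) := by
        rw [hg, hw, excitation, ← Matrix.mulVec_sub, ← Matrix.mulVec_sub, ← Matrix.mulVec_neg,
          ← Matrix.mulVec_neg]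
        congr 2
        simp
      have h1 : ‖(Γ τ).transpose.mulVec w - g τ‖ ≤
          5 * M * (C * (3 * M * (η t / 2 + η t / 2 * T))) := by
        rw [e, norm_neg]
        refine (norm_mulVec_le hM0 (fun i j => hM τ (hsub hτ) j i) _).trans ?_
        rw [Fintype.card_fin]
        push_cast
        refine mul_le_mul_of_nonneg_left ((hC _).trans ?_) (by positivity)
        exact mul_le_mul_of_nonneg_left (hdisp τ hτ) hC0
      have h2 := dotProduct_self_le ((Γ τ).transpose.mulVec w - g τ)
      rw [Fintype.card_fin] at h2
      push_cast at h2
      have h3 := pow_le_pow_left₀ (norm_nonneg _) h1 2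
      linarith
    have hgc : ContinuousOn (fun τ => g τ ⬝ᵥ g τ) (Icc t (t + T)) := by
      simp only [dotProduct]
      exact continuousOn_finsetSum _ fun j _ =>
        (continuousOn_excitation (hxc.mono hsub) (fun i j => (hΓ i j).mono hsub) j).mul
        (continuousOn_excitation (hxc.mono hsub) (fun i j => (hΓ i j).mono hsub) j)
    have hgi : IntervalIntegrable (fun τ => g τ ⬝ᵥ g τ) MeasureTheory.volume t (t + T) :=
      hgc.intervalIntegrable_of_Icc (by linarith)
    have hwi : IntervalIntegrable
        (fun τ => (Γ τ).transpose.mulVec w ⬝ᵥ (Γ τ).transpose.mulVec w)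
        MeasureTheory.volume t (t + T) := by
      refine ContinuousOn.intervalIntegrable_of_Icc (by linarith) ?_
      simp only [dotProduct, Matrix.mulVec, Matrix.transpose_apply]
      have : ∀ j, ContinuousOn (fun τ => ∑ i, Γ τ i j * w i) (Icc t (t + T)) := fun j =>
        continuousOn_finsetSum _ fun i _ => ((hΓ i j).mono hsub).mul continuousOn_const
      exact continuousOn_finsetSum _ fun j _ => (this j).mul (this j)
    have hFTC : ∫ τ in t..(t + T), g τ ⬝ᵥ g τ = V t - V (t + T) := by
      have h1 : ∫ τ in t..(t + T), -(g τ ⬝ᵥ g τ) = V (t + T) - V t := by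
        refine intervalIntegral.integral_eq_sub_of_hasDeriv_right ?_ ?_ hgi.neg
        · rw [uIcc_of_le (by linarith)]
          exact hVc.mono hsub
        · intro s hs
          rw [min_eq_left (by linarith), max_eq_right (by linarith)] at hs
          have hs1 : t₁ ≤ s := ht.trans hs.1.le
          exact (hV s hs1).mono fun y hy => hs1.trans (mem_Ioi.1 hy).le
      rw [intervalIntegral.integral_neg] at h1
      linarith
    calc α * ‖w‖ ^ 2 ≤ α * (w ⬝ᵥ w) :=
          mul_le_mul_of_nonneg_left (norm_sq_le_dotProduct_self w) hα.le
      _ ≤ ∫ τ in t..(t + T), (Γ τ).transpose.mulVec w ⬝ᵥ (Γ τ).transpose.mulVec w :=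
          mul_dotProduct_le_integral hT (hPE t ht) (fun i j => (hΓ i j).mono hsub) w
      _ ≤ ∫ τ in t..(t + T), (2 * (g τ ⬝ᵥ g τ) +
            6 * (5 * M * (C * (3 * M * (η t / 2 + η t / 2 * T)))) ^ 2) :=
          intervalIntegral.integral_mono_on (by linarith) hwi
            ((hgi.const_mul 2).add intervalIntegrable_const) hpt
      _ = _ := by
          rw [intervalIntegral.integral_add (hgi.const_mul 2) intervalIntegrable_const,
            intervalIntegral.integral_const_mul, hFTC, intervalIntegral.integral_const,
            add_sub_cancel_left, smul_eq_mul]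
  have hbound : Tendsto (fun t => (2 * (V t - V (t + T)) +
      T * (6 * (5 * M * (C * (3 * M * (η t / 2 + η t / 2 * T)))) ^ 2)) / α) atTop (𝓝 0) := by
    have h1 : Tendsto (fun t => η t / 2 + η t / 2 * T) atTop (𝓝 0) := by
      simpa using (hηlim.div_const 2).add ((hηlim.div_const 2).mul_const T)
    have h2 := ((((h1.const_mul (3 * M)).const_mul C).const_mul (5 * M)).pow 2).const_mul 6
    simpa using ((hD.const_mul 2).add (h2.const_mul T)).div_const α
  have hsq : Tendsto (fun t => ‖P.mulVec (x t - xd).ofLp‖ ^ 2) atTop (𝓝 0) := by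
    refine squeeze_zero' (Eventually.of_forall fun t => by positivity) ?_ hbound
    filter_upwards [eventually_ge_atTop t₁] with t ht
    rw [le_div_iff₀ hα, mul_comm]
    exact key t ht
  have hw : Tendsto (fun t => P.mulVec (x t - xd).ofLp) atTop (𝓝 0) := by
    refine tendsto_zero_iff_norm_tendsto_zero.2 ?_
    simpa using hsq.sqrt
  have hdet : IsUnit P.det := hP.det_pos.ne'.isUnit
  have hz : Tendsto (fun t => (x t - xd).ofLp) atTop (𝓝 0) := by
    have hcont : Continuous (P⁻¹.mulVec) := Continuous.matrix_mulVec continuous_const continuous_id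
    have := (hcont.tendsto 0).comp hw
    simpa [Function.comp_def, Matrix.mulVec_mulVec, Matrix.nonsing_inv_mul _ hdet] using this
  have hz' : Tendsto (fun t => x t - xd) atTop (𝓝 0) := by
    have := ((PiLp.continuous_toLp 2 fun _ : Fin 5 => ℝ).tendsto 0).comp hz
    simpa [Function.comp_def] using this
  simpa using hz'.add_const xd

end ErrorEquation

/-! ### Compactness of the terminal sets -/

theorem continuous_V₀ (P : Matrix (Fin 5) (Fin 5) ℝ) (Xd : State) :
    Continuous fun X : State => V₀ P X Xd := by
  have h : ∀ i, Continuous fun X : State => (X - Xd).ofLp i := fun i => by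
    simp only [PiLp.sub_apply]; fun_prop
  simp only [V₀, dotProduct, Matrix.mulVec]
  fun_prop

/-- `m` is the minimum of `V₀ P · 0` on the unit sphere, positive by compactness; homogeneity of
degree two does the rest. -/
theorem exists_mul_norm_sq_le_V₀ {P : Matrix (Fin 5) (Fin 5) ℝ} (hP : P.PosDef) :
    ∃ m > 0, ∀ X Xd : State, m * ‖X - Xd‖ ^ 2 ≤ V₀ P X Xd := by
  have hne : (Metric.sphere (0 : State) 1).Nonempty := NormedSpace.sphere_nonempty.2 zero_le_one
  obtain ⟨y, hy, hmin⟩ := (isCompact_sphere (0 : State) 1).exists_isMinOn hne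
    (continuous_V₀ P 0).continuousOn
  have hy0 : y ≠ 0 := by
    rintro rfl
    simp at hy
  refine ⟨V₀ P y 0, ?_, fun X Xd => ?_⟩
  · have := hP.dotProduct_mulVec_pos (x := y.ofLp) (by simpa using hy0)
    rw [star_trivial] at this
    simp only [V₀, sub_zero]
    linarith
  · by_cases h : X - Xd = 0
    · simp [V₀, h]
    · have hn : 0 < ‖X - Xd‖ := norm_pos_iff.2 h
      have hmem : ‖X - Xd‖⁻¹ • (X - Xd) ∈ Metric.sphere (0 : State) 1 := by
        simp [norm_smul, hn.ne']
      have := hmin hmem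
      simp only [mem_ofPred_eq] at this
      have e : V₀ P (‖X - Xd‖⁻¹ • (X - Xd)) 0 = (‖X - Xd‖⁻¹) ^ 2 * V₀ P X Xd := by
        simp only [V₀, sub_zero, WithLp.ofLp_smul, Matrix.mulVec_smul, dotProduct_smul,
          smul_dotProduct, smul_eq_mul]
        ring
      rw [e, inv_pow, inv_mul_eq_div, le_div_iff₀ (by positivity)] at this
      exact this

theorem isCompact_Q (par : Params) (c₀ : State → ℝ) (Xd : State) : IsCompact (Q par c₀ Xd) := by
  obtain ⟨m, hm, h⟩ := exists_mul_norm_sq_le_V₀ par.P_posDef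
  refine Metric.isCompact_of_isClosed_isBounded
    (isClosed_le (continuous_V₀ par.P Xd) continuous_const) ?_
  refine (Metric.isBounded_closedBall (x := Xd) (r := Real.sqrt (c₀ Xd / m))).subset fun X hX => ?_
  rw [Metric.mem_closedBall, dist_eq_norm]
  refine Real.le_sqrt_of_sq_le ?_
  rw [le_div_iff₀ hm, mul_comm]
  exact (h X Xd).trans hX

theorem exists_abs_G_le (par : Params) {K : Set State} (hK : IsCompact K) (hKR : K ⊆ Regular) :
    ∃ M, 0 ≤ M ∧ ∀ X ∈ K, ∀ θ i j, |G par X θ i j| ≤ M := by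
  have hcomp : IsCompact (K ×ˢ Icc 0 (2 * Real.pi)) := hK.prod isCompact_Icc
  have : ∀ i j, ∃ M, ∀ z ∈ K ×ˢ Icc 0 (2 * Real.pi), ‖G par z.1 z.2 i j‖ ≤ M := fun i j =>
    hcomp.exists_bound_of_continuousOn fun z hz =>
      (contDiffAt_G par (hKR hz.1) i j).continuousAt.continuousWithinAt
  choose M hM using this
  refine ⟨∑ i, ∑ j, |M i j|, by positivity, fun X hX θ i j => ?_⟩
  obtain ⟨θ', hθ', k, rfl⟩ := exists_eq_add_int_mul_two_pi θ
  rw [G_add_int_mul_two_pi]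
  calc |G par X θ' i j| ≤ |M i j| :=
        (hM i j (X, θ') ⟨hX, Ico_subset_Icc_self hθ'⟩).trans (le_abs_self _)
    _ ≤ ∑ j, |M i j| :=
        Finset.single_le_sum (f := fun j => |M i j|) (fun _ _ => abs_nonneg _) (Finset.mem_univ j)
    _ ≤ ∑ i, ∑ j, |M i j| :=
        Finset.single_le_sum (f := fun i => ∑ j, |M i j|) (fun _ _ => by positivity)
          (Finset.mem_univ i)

/-! ### Closed-loop trajectories and terminal sets -/

theorem IsTrajectory.mono {par : Params} {u : State → ℝ → Control} {x : ℝ → State} {ϑ : ℝ → ℝ}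
    {s s' : Set ℝ} (h : IsTrajectory par u x ϑ s) (hs : s' ⊆ s) : IsTrajectory par u x ϑ s' :=
  isTrajectory_iff.2 ((isTrajectory_iff.1 h).mono hs)

theorem SolvesOn.isTrajectory {par : Params} {u : State → ℝ → Control} {z : ℝ → State × ℝ}
    {s : Set ℝ} (h : SolvesOn (loopField par u) RegularPhase z s) :
    IsTrajectory par u (fun t => (z t).1) (fun t => (z t).2) s :=
  isTrajectory_iff.2 h

/-- Uniqueness of closed-loop trajectories. -/
theorem IsTrajectory.eqOn {par : Params} {Xd : State} {x y : ℝ → State} {ϑ φ : ℝ → ℝ} {s s' : ℝ}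
    (hx : IsTrajectory par (Usat par Xd) x ϑ (Icc s s'))
    (hy : IsTrajectory par (Usat par Xd) y φ (Icc s s')) (h₁ : x s = y s) (h₂ : ϑ s = φ s) :
    EqOn x y (Icc s s') ∧ EqOn ϑ φ (Icc s s') := by
  have := (isTrajectory_iff.1 hx).eqOn (lipAt_satLoop par Xd) (isTrajectory_iff.1 hy)
    (by simp only [h₁, h₂])
  exact ⟨fun t ht => congrArg Prod.fst (this ht), fun t ht => congrArg Prod.snd (this ht)⟩

section Terminal

variable {par : Params} {c₀ : State → ℝ} {thor : ℝ} {𝒯 : Set State} {ε : ℝ} {Xd : State}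

theorem A2.terminalCond_self (h : A2 par c₀ thor 𝒯 ε) (hε : 0 < ε) (hXd : Xd ∈ 𝒯) {X : State}
    (hX : X ∈ Q par c₀ Xd) (t θ : ℝ) : TerminalCond par c₀ thor t X θ Xd :=
  h.terminalCond hXd hXd (by simpa using hε.le) hX t θ

/-- The ellipsoid is defined without reference to singularities, but (A2) includes the existence of
a trajectory from each of its points, and trajectories stay in `Regular`. -/
theorem A2.Q_subset_regular (h : A2 par c₀ thor 𝒯 ε) (hε : 0 < ε) (hthor : 0 < thor)
    (hXd : Xd ∈ 𝒯) : Q par c₀ Xd ⊆ Regular := by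
  intro X hX
  obtain ⟨Y, -, x, ϑ, hx, h0, -⟩ := h.terminalCond_self hε hXd hX 0 0
  rw [← h0]
  exact (hx 0 ⟨le_rfl, by linarith⟩).1

/-- Positive invariance of the terminal sets. -/
theorem A1.mem_Q (h : A1 par c₀ 𝒯) (hXd : Xd ∈ 𝒯) {x : ℝ → State} {ϑ : ℝ → ℝ} {s s' : ℝ}
    (hx : IsTrajectory par (Usat par Xd) x ϑ (Icc s s')) (hs : x s ∈ Q par c₀ Xd) :
    ∀ τ ∈ Icc s s', x τ ∈ Q par c₀ Xd := fun _ hτ =>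
  (hx.V₀_le (h Xd hXd _ hs).1 (h Xd hXd _ hs).2 hτ).trans hs

/-- With zero adjustment, (A2) returns to the same terminal set after each horizon, so it can be
applied again from there indefinitely. -/
theorem A2.exists_trajectory (h : A2 par c₀ thor 𝒯 ε) (hε : 0 < ε) (hthor : 0 < thor)
    (hXd : Xd ∈ 𝒯) {X₀ : State} (hX₀ : X₀ ∈ Q par c₀ Xd) (s θ₀ : ℝ) :
    ∃ (x : ℝ → State) (ϑ : ℝ → ℝ),
      IsTrajectory par (Usat par Xd) x ϑ (Ici s) ∧ x s = X₀ ∧ ϑ s = θ₀ := by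
  obtain ⟨z, hz, hz0⟩ := SolvesOn.exists_Ici_of_step (S := {z | z.1 ∈ Q par c₀ Xd})
    (z₀ := (X₀, θ₀)) (lipAt_satLoop par Xd) hthor (fun t y hy => by
      obtain ⟨Y, hY, x, ϑ, hx, h1, h2, h3⟩ := h.terminalCond_self hε hXd hy t y.2
      exact ⟨fun t => (x t, ϑ t), isTrajectory_iff.1 hx, by simp [h1, h2],
        by simpa [h3] using hY⟩) hX₀ s
  exact ⟨_, _, hz.isTrajectory, by rw [hz0], by rw [hz0]⟩

/-- If the terminal-set condition holds, then the closed loop with frozen target continues for all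
times and stays in the terminal set once the horizon has passed. -/
theorem TerminalCond.exists_trajectory {t θ : ℝ} {X : State}
    (hT : TerminalCond par c₀ thor t X θ Xd) (hA1 : A1 par c₀ 𝒯) (hA2 : A2 par c₀ thor 𝒯 ε)
    (hε : 0 < ε) (hthor : 0 < thor) (hXd : Xd ∈ 𝒯) :
    ∃ (x : ℝ → State) (ϑ : ℝ → ℝ), IsTrajectory par (Usat par Xd) x ϑ (Ici t) ∧
      x t = X ∧ ϑ t = θ ∧ ∀ τ ≥ t + thor, x τ ∈ Q par c₀ Xd := by
  obtain ⟨Y, hY, x, ϑ, hx, h1, h2, h3⟩ := hT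
  obtain ⟨y, φ, hy, h4, h5⟩ := hA2.exists_trajectory hε hthor hXd hY (t + thor) (ϑ (t + thor))
  have hle : t ≤ t + thor := by linarith
  have glue : ∀ b, ∃ v, SolvesOn (loopField par (Usat par Xd)) RegularPhase v (Icc t b) ∧
      v t = (X, θ) := fun b => by
    obtain ⟨v, hv, e, -⟩ := (isTrajectory_iff.1 hx).glue hle
      (isTrajectory_iff.1 (hy.mono (Icc_subset_Ici_self (a := b)))) (by simp only [h3, h4, h5])
    exact ⟨v, hv, by simp [e ⟨le_rfl, hle⟩, h1, h2]⟩
  obtain ⟨v, hv, hv0⟩ := SolvesOn.exists_Ici (lipAt_satLoop par Xd) fun n => glue (t + n)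
  have hv' := hv.isTrajectory
  -- `v` is known only by its initial value; uniqueness identifies it with the given prediction up
  -- to `t + thor`.
  have hend : (v (t + thor)).1 ∈ Q par c₀ Xd := by
    have := (hv'.mono (Icc_subset_Ici_self (a := t + thor))).eqOn hx (by simp [hv0, h1])
      (by simp [hv0, h2])
    have hve : (v (t + thor)).1 = x (t + thor) := this.1 ⟨hle, le_rfl⟩
    rw [hve, h3]
    exact hY
  refine ⟨_, _, hv', by simp [hv0], by simp [hv0], fun τ hτ => ?_⟩
  exact hA1.mem_Q hXd (hv'.mono fun s (hs : s ∈ Icc (t + thor) τ) => hle.trans hs.1) hend τ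
    ⟨hτ, le_rfl⟩

/-- Along the closed loop with frozen target, the terminal-set condition persists. -/
theorem TerminalCond.of_trajectory {t τ : ℝ} {x : ℝ → State} {ϑ : ℝ → ℝ}
    (hT : TerminalCond par c₀ thor t (x t) (ϑ t) Xd) (hA1 : A1 par c₀ 𝒯)
    (hA2 : A2 par c₀ thor 𝒯 ε) (hε : 0 < ε) (hthor : 0 < thor) (hXd : Xd ∈ 𝒯) (hτ : t ≤ τ)
    (hx : IsTrajectory par (Usat par Xd) x ϑ (Icc t τ)) :
    TerminalCond par c₀ thor τ (x τ) (ϑ τ) Xd := by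
  obtain ⟨y, φ, hy, h1, h2, h3⟩ := hT.exists_trajectory hA1 hA2 hε hthor hXd
  have := hx.eqOn (hy.mono Icc_subset_Ici_self) h1.symm h2.symm
  exact ⟨_, h3 (τ + thor) (by linarith), y, φ, hy.mono fun s hs => hτ.trans hs.1,
    (this.1 ⟨hτ, le_rfl⟩).symm, (this.2 ⟨hτ, le_rfl⟩).symm, rfl⟩

end Terminal

/-! ### The reference governor -/

section Governor

variable {par : Params} {c₀ : State → ℝ} {thor ε δ : ℝ} {Xdes : State} {t : ℕ → ℝ}
  {X : ℝ → State} {θ : ℝ → ℝ} {κ : ℕ → ℝ} {Xt : ℕ → State}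

@[simp] theorem adjust_zero (Xdes Xprev : State) : adjust Xdes Xprev 0 = Xprev := by
  simp [adjust]

@[simp] theorem adjust_one (Xdes Xprev : State) : adjust Xdes Xprev 1 = Xdes := by
  simp [adjust]

theorem norm_adjust_sub (Xdes Xprev : State) {κ : ℝ} (hκ : 0 ≤ κ) :
    ‖adjust Xdes Xprev κ - Xprev‖ = κ * ‖Xdes - Xprev‖ := by
  rw [adjust, add_sub_cancel_left, norm_smul, Real.norm_of_nonneg hκ]

theorem norm_sub_adjust (Xdes Xprev : State) {κ : ℝ} (hκ : κ ≤ 1) :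
    ‖Xdes - adjust Xdes Xprev κ‖ = (1 - κ) * ‖Xdes - Xprev‖ := by
  have : Xdes - adjust Xdes Xprev κ = (1 - κ) • (Xdes - Xprev) := by
    rw [adjust]; module
  rw [this, norm_smul, Real.norm_of_nonneg (sub_nonneg.2 hκ)]

theorem adjust_mem_segment {A Xdes Xprev : State} (h : Xprev ∈ segment ℝ A Xdes) {κ : ℝ}
    (hκ : κ ∈ Icc (0 : ℝ) 1) : adjust Xdes Xprev κ ∈ segment ℝ A Xdes :=
  (convex_segment A Xdes).add_smul_sub_mem h (right_mem_segment ℝ A Xdes) hκ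

theorem IsGovernorChoice.mem_Icc {s : ℝ} {X₀ Xprev : State} {θ₀ k : ℝ}
    (h : IsGovernorChoice par c₀ thor δ Xdes s X₀ θ₀ Xprev k) : k ∈ Icc (0 : ℝ) 1 := by
  obtain ⟨κmax, hmax, h1, h2⟩ := h
  by_cases hc : δ ≤ ‖adjust Xdes Xprev κmax - Xprev‖ ∨ adjust Xdes Xprev κmax = Xdes
  · rw [h1 hc]; exact hmax.1.1
  · rw [h2 hc]; simp

/-- Recursive feasibility: the virtual targets stay on the segment and satisfy the terminal-set
condition. -/
theorem IsGovernedUpTo.feasible (ht : StrictMono t)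
    (hA1 : A1 par c₀ (segment ℝ (Xt 0) Xdes)) (hA2 : A2 par c₀ thor (segment ℝ (Xt 0) Xdes) ε)
    (hε : 0 < ε) (hthor : 0 < thor) {N : ℕ}
    (h : IsGovernedUpTo par c₀ thor δ Xdes t X θ κ Xt N) :
    Xt N ∈ segment ℝ (Xt 0) Xdes ∧
      TerminalCond par c₀ thor (t N) (X (t N)) (θ (t N)) (Xt N) := by
  induction N with
  | zero => exact ⟨left_mem_segment ℝ _ _, h.init⟩
  | succ N ih =>
    obtain ⟨hmem, hT⟩ := ih
      { init := h.init
        dynamics := fun n hn => h.dynamics n (by omega)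
        choice := fun n hn => h.choice n (by omega)
        target := fun n hn => h.target n (by omega) }
    have hch := h.choice N (Nat.lt_succ_self N)
    rw [h.target N (Nat.lt_succ_self N)]
    refine ⟨adjust_mem_segment hmem hch.mem_Icc, ?_⟩
    obtain ⟨κmax, hmax, h1, h2⟩ := hch
    -- An accepted move is feasible by choice of `κmax`; after a rejection the old target is kept,
    -- and its condition persists along the flow.
    by_cases hc : δ ≤ ‖adjust Xdes (Xt N) κmax - Xt N‖ ∨ adjust Xdes (Xt N) κmax = Xdes
    · rw [h1 hc]; exact hmax.1.2
    · rw [h2 hc, adjust_zero]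
      exact hT.of_trajectory hA1 hA2 hε hthor hmem (ht (Nat.lt_succ_self N)).le
        (h.dynamics N (Nat.lt_succ_self N))

/-- If the virtual target is eventually constant, the governed closed loop is eventually a
trajectory of the closed loop with that target. -/
theorem isTrajectory_of_target_const (ht : StrictMono t) (ht_top : Tendsto t atTop atTop)
    (h : ∀ N, IsGovernedUpTo par c₀ thor δ Xdes t X θ κ Xt N) {N : ℕ} {Xd : State}
    (hXd : ∀ n ≥ N, Xt n = Xd) : IsTrajectory par (Usat par Xd) X θ (Ici (t N)) := by
  have hpiece : ∀ n ≥ N, SolvesOn (loopField par (Usat par Xd)) RegularPhase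
      (fun s => (X s, θ s)) (Icc (t n) (t (n + 1))) := fun n hn => by
    have := (h (n + 1)).dynamics n (Nat.lt_succ_self n)
    rw [hXd n hn] at this
    exact isTrajectory_iff.1 this
  have hfin : ∀ k, SolvesOn (loopField par (Usat par Xd)) RegularPhase
      (fun s => (X s, θ s)) (Icc (t N) (t (N + k + 1))) := fun k => by
    induction k with
    | zero => exact hpiece N le_rfl
    | succ k ih =>
      exact ih.union_Icc (ht.monotone (by omega)) (hpiece (N + k + 1) (by omega))
  refine isTrajectory_iff.2 (SolvesOn.Ici_of_Icc fun b => ?_)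
  obtain ⟨m, hm⟩ := (ht_top.eventually_ge_atTop b).exists
  exact (hfin m).mono (Icc_subset_Icc_right (hm.trans (ht.monotone (by omega))))

theorem mem_Q_of_target_const (ht : StrictMono t) (ht_top : Tendsto t atTop atTop)
    (hA1 : A1 par c₀ (segment ℝ (Xt 0) Xdes)) (hA2 : A2 par c₀ thor (segment ℝ (Xt 0) Xdes) ε)
    (hε : 0 < ε) (hthor : 0 < thor)
    (h : ∀ N, IsGovernedUpTo par c₀ thor δ Xdes t X θ κ Xt N) {N : ℕ} {Xd : State}
    (hXd : ∀ n ≥ N, Xt n = Xd) : ∀ τ ≥ t N + thor, X τ ∈ Q par c₀ Xd := by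
  intro τ hτ
  obtain ⟨hmem, hT⟩ := (h N).feasible ht hA1 hA2 hε hthor
  rw [hXd N le_rfl] at hmem hT
  obtain ⟨y, φ, hy, h1, h2, h3⟩ := hT.exists_trajectory hA1 hA2 hε hthor hmem
  have := ((isTrajectory_of_target_const ht ht_top h hXd).mono
    (Icc_subset_Ici_self (a := τ))).eqOn (hy.mono Icc_subset_Ici_self) h1.symm h2.symm
  rw [this.1 ⟨by linarith, le_rfl⟩]
  exact h3 τ hτ

/-- A state in the terminal set of the current target lets the governor move the target. -/
theorem IsGovernorChoice.adjust_ne {s : ℝ} {X₀ Xprev A : State} {θ₀ k : ℝ}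
    (h : IsGovernorChoice par c₀ thor δ Xdes s X₀ θ₀ Xprev k)
    (hA2 : A2 par c₀ thor (segment ℝ A Xdes) ε) (hε : 0 < ε) (hδε : δ < ε)
    (hprev : Xprev ∈ segment ℝ A Xdes) (hX₀ : X₀ ∈ Q par c₀ Xprev) (hne : Xprev ≠ Xdes) :
    adjust Xdes Xprev k ≠ Xprev := by
  obtain ⟨κmax, hmax, h1, -⟩ := h
  have hd : 0 < ‖Xdes - Xprev‖ := norm_pos_iff.2 (sub_ne_zero.2 hne.symm)
  have hk0 : 0 ≤ κmax := hmax.1.1.1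
  have hfeas : ∀ k' ∈ Icc (0 : ℝ) 1, k' * ‖Xdes - Xprev‖ ≤ ε → k' ≤ κmax := fun k' hk' hle => by
    refine hmax.2 ⟨hk', ?_⟩
    refine hA2.terminalCond hprev (adjust_mem_segment hprev hk') ?_ hX₀ s θ₀
    rwa [norm_adjust_sub _ _ hk'.1]
  rcases le_total ‖Xdes - Xprev‖ ε with hle | hle
  · have : κmax = 1 := le_antisymm hmax.1.1.2 (hfeas 1 (by simp) (by simpa using hle))
    subst this
    rw [h1 (Or.inr (adjust_one _ _)), adjust_one]
    exact hne.symm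
  -- This `κ` displaces the target by exactly `ε`, so the maximal move is longer than `δ` and is not
  -- rejected.
  · have hq : ε / ‖Xdes - Xprev‖ ≤ κmax :=
      hfeas _ ⟨by positivity, (div_le_one hd).2 hle⟩ (div_mul_cancel₀ _ hd.ne').le
    rw [div_le_iff₀ hd, ← norm_adjust_sub _ _ hk0] at hq
    rw [h1 (Or.inl (by linarith))]
    intro heq
    rw [heq, sub_self, norm_zero] at hq
    linarith

/-- The governor reaches the target after finitely many adjustments. -/
theorem eventually_target_eq (ht : StrictMono t) (ht_top : Tendsto t atTop atTop)
    (hA1 : A1 par c₀ (segment ℝ (Xt 0) Xdes)) (hA2 : A2 par c₀ thor (segment ℝ (Xt 0) Xdes) ε)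
    (hε : 0 < ε) (hthor : 0 < thor) (hδ : 0 < δ) (hδε : δ < ε)
    (h : ∀ N, IsGovernedUpTo par c₀ thor δ Xdes t X θ κ Xt N) :
    ∃ N, ∀ n ≥ N, Xt n = Xdes := by
  have htarget : ∀ n, Xt (n + 1) = adjust Xdes (Xt n) (κ (n + 1)) := fun n =>
    (h (n + 1)).target n (Nat.lt_succ_self n)
  have hchoice := fun n => (h (n + 1)).choice n (Nat.lt_succ_self n)
  have hκ : ∀ n, κ (n + 1) ∈ Icc (0 : ℝ) 1 := fun n => (hchoice n).mem_Icc
  by_cases hex : ∃ N, Xt N = Xdes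
  · obtain ⟨N, hN⟩ := hex
    refine ⟨N, fun n hn => ?_⟩
    induction n, hn using Nat.le_induction with
    | base => exact hN
    | succ n _ ih => rw [htarget, ih]; simp [adjust]
  exfalso
  push Not at hex
  have hstep : ∀ n, Xt (n + 1) = Xt n ∨ ‖Xdes - Xt (n + 1)‖ + δ ≤ ‖Xdes - Xt n‖ := by
    intro n
    obtain ⟨κmax, hmax, h1, h2⟩ := hchoice n
    by_cases hc : δ ≤ ‖adjust Xdes (Xt n) κmax - Xt n‖ ∨ adjust Xdes (Xt n) κmax = Xdes
    · right
      have hk := h1 hc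
      rw [← hk, ← htarget] at hc
      have hge := hc.resolve_right (hex (n + 1))
      rw [htarget, norm_adjust_sub _ _ (hκ n).1] at hge
      rw [htarget, norm_sub_adjust _ _ (hκ n).2]
      linarith
    · left
      rw [htarget, h2 hc, adjust_zero]
  have hanti : Antitone fun n => ‖Xdes - Xt n‖ := antitone_nat_of_succ_le fun n => by
    rcases hstep n with h | h
    · rw [h]
    · linarith
  have hbdd : BddBelow (range fun n => ‖Xdes - Xt n‖) :=
    ⟨0, by rintro _ ⟨n, rfl⟩; exact norm_nonneg _⟩
  -- The distance at `N` is within `δ` of its infimum, which leaves no room for a further accepted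
  -- move.
  obtain ⟨N, hN⟩ := exists_lt_of_ciInf_lt (lt_add_of_pos_right (⨅ n, ‖Xdes - Xt n‖) hδ)
  have hconst : ∀ n ≥ N, Xt n = Xt N := by
    intro n hn
    induction n, hn using Nat.le_induction with
    | base => rfl
    | succ n hn ih =>
      rcases hstep n with h | h
      · rw [h, ih]
      · have h1 := ciInf_le hbdd (n + 1)
        have h2 := hanti hn
        simp only at h1 h2
        linarith
  obtain ⟨m, hm⟩ := (ht_top.eventually_ge_atTop (t N + thor)).exists
  have hle : t N + thor ≤ t (N + m + 1) := hm.trans (ht.monotone (by omega))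
  have hQ := mem_Q_of_target_const ht ht_top hA1 hA2 hε hthor h hconst _ hle
  have hseg := ((h N).feasible ht hA1 hA2 hε hthor).1
  have hch := hchoice (N + m)
  rw [hconst (N + m) (by omega)] at hch
  refine hch.adjust_ne hA2 hε hδε hseg hQ (hex N) ?_
  rw [← hconst (N + m) (by omega), ← htarget, hconst (N + m + 1) (by omega),
    hconst (N + m) (by omega)]

/-- (A3) switches off the saturation and (A1) the barrier gradients. -/
theorem Usat_eq_Uunc {𝒯 : Set State} (hA1 : A1 par c₀ 𝒯) (hA3 : A3 par c₀ Xdes)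
    (hXdes : Xdes ∈ 𝒯) {Y : State} (hY : Y ∈ Q par c₀ Xdes) (φ : ℝ) :
    Usat par Xdes Y φ = Uunc par Xdes Y φ := by
  obtain ⟨h1, h2⟩ := hA1 Xdes hXdes Y hY
  rw [Usat, if_pos (hA3.norm_Unom_le hY φ), Unom, Uunc, gradB₁_eq_zero h1, gradB₂_eq_zero h2,
    add_zero, add_zero]

theorem IsTrajectory.of_feedback_eq {u u' : State → ℝ → Control} {x : ℝ → State} {ϑ : ℝ → ℝ}
    {s : Set ℝ} (h : IsTrajectory par u x ϑ s) (huu' : ∀ τ ∈ s, u (x τ) (ϑ τ) = u' (x τ) (ϑ τ)) :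
    IsTrajectory par u' x ϑ s := fun τ hτ => by
  rw [← huu' τ hτ]
  exact h τ hτ

/-- Under the nominal unconstrained law, persistent excitation implies convergence. -/
theorem IsTrajectory.tendsto_of_persistentlyExciting {x : ℝ → State} {ϑ : ℝ → ℝ} {T t₀ : ℝ}
    (h : IsTrajectory par (Uunc par Xdes) x ϑ (Ici T)) (hT : t₀ ≤ T)
    {K : Set State} (hK : IsCompact K) (hKR : K ⊆ Regular) (hx : ∀ τ ≥ T, x τ ∈ K)
    (hPE : PersistentlyExciting (fun τ => G par (x τ) (ϑ τ)) t₀) :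
    Tendsto x atTop (𝓝 Xdes) := by
  obtain ⟨M, hM0, hM⟩ := exists_abs_G_le par hK hKR
  obtain ⟨W, hW, α, hα, hPE⟩ := hPE
  have hc := (isTrajectory_iff.1 h).continuousOn
  refine tendsto_of_excitation (Γ := fun τ => G par (x τ) (ϑ τ)) (t₁ := T) par.P_posDef
    par.P_isSymm (fun τ hτ => (h τ hτ).2.1) (fun i j τ hτ => ?_) hM0
    (fun τ hτ i j => hM _ (hx τ hτ) _ i j) hW (α := α) (by exact_mod_cast hα) fun τ hτ => ?_
  · exact ContinuousAt.comp_continuousWithinAt (f := fun τ => (x τ, ϑ τ))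
      (contDiffAt_G par (h τ hτ).1 i j).continuousAt (hc τ hτ)
  -- In `PersistentlyExciting` the level `α` is elaborated as a natural number, so it is at least
  -- `1` and is cast to `ℝ` here. For continuous `Γ` this loses nothing: a window `k` times as long
  -- carries `k` times the level.
  · rw [Nat.cast_smul_eq_nsmul ℝ]
    exact hPE τ (hT.trans hτ)

end Governor

end OrbitalTransfer

theorem mainTheorem4 (par : Params) (Xdes : State) (c₀ : State → ℝ) (thor : ℝ)
    (hthor : 0 < thor)
    -- sampling instants, closed-loop trajectory, governor parameters, virtual targets
    (t : ℕ → ℝ) (ht : StrictMono t) (ht_top : Tendsto t atTop atTop)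
    (X : ℝ → State) (θ : ℝ → ℝ) (κ : ℕ → ℝ) (Xt : ℕ → State)
    -- the virtual targets range over the segment from the initial one to `Xdes`
    (hc₀ : ∀ Xd ∈ segment ℝ (Xt 0) Xdes, 0 < c₀ Xd)
    (hA1 : A1 par c₀ (segment ℝ (Xt 0) Xdes))
    (ε : ℝ) (hε : 0 < ε) (hA2 : A2 par c₀ thor (segment ℝ (Xt 0) Xdes) ε)
    (hA3 : A3 par c₀ Xdes)
    (δ : ℝ) (hδ : 0 < δ) (hδε : δ < ε) :
    -- the initial state itself is a feasible initial virtual target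
    (∀ X₀ ∈ Regular, B₁ par X₀ = 0 → B₂ par X₀ = 0 → 0 < c₀ X₀ →
      ∀ s θ₀ : ℝ, TerminalCond par c₀ thor s X₀ θ₀ X₀) ∧
    -- positive invariance of the terminal sets: solutions from them exist for all future
    -- times, and no solution leaves them
    (∀ Xd ∈ segment ℝ (Xt 0) Xdes,
      (∀ X₀ ∈ Q par c₀ Xd, ∀ s θ₀ : ℝ, ∃ (x : ℝ → State) (ϑ : ℝ → ℝ),
        IsTrajectory par (Usat par Xd) x ϑ (Ici s) ∧ x s = X₀ ∧ ϑ s = θ₀) ∧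
      (∀ (x : ℝ → State) (ϑ : ℝ → ℝ) (s s' : ℝ),
        IsTrajectory par (Usat par Xd) x ϑ (Icc s s') → x s ∈ Q par c₀ Xd →
        ∀ τ ∈ Icc s s', x τ ∈ Q par c₀ Xd)) ∧
    -- recursive feasibility
    (∀ N, IsGovernedUpTo par c₀ thor δ Xdes t X θ κ Xt N →
      TerminalCond par c₀ thor (t N) (X (t N)) (θ (t N)) (Xt N) ∧
      -- with the virtual target frozen, the closed loop continues for all times, enters the
      -- terminal set within the horizon and stays there
      (∃ (x : ℝ → State) (ϑ : ℝ → ℝ), IsTrajectory par (Usat par (Xt N)) x ϑ (Ici (t N)) ∧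
        x (t N) = X (t N) ∧ ϑ (t N) = θ (t N) ∧
        ∀ τ ≥ t N + thor, x τ ∈ Q par c₀ (Xt N)) ∧
      -- whatever the next sampling instant `τ`, the value `0` is feasible there
      (∀ τ ≥ t N, ∀ (x : ℝ → State) (ϑ : ℝ → ℝ),
        IsTrajectory par (Usat par (Xt N)) x ϑ (Icc (t N) τ) →
        x (t N) = X (t N) → ϑ (t N) = θ (t N) →
        (0 : ℝ) ∈ feasible par c₀ thor Xdes τ (x τ) (ϑ τ) (Xt N))) ∧
    -- convergence
    ((∀ N, IsGovernedUpTo par c₀ thor δ Xdes t X θ κ Xt N) →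
      (∃ N, ∀ n ≥ N, Xt n = Xdes) ∧
      (∃ T ≥ t 0, (∀ τ ≥ T, X τ ∈ Q par c₀ Xdes) ∧
        (∀ τ ≥ T, Usat par Xdes (X τ) (θ τ) = Uunc par Xdes (X τ) (θ τ)) ∧
        IsTrajectory par (Uunc par Xdes) X θ (Ici T)) ∧
      (PersistentlyExciting (fun τ => G par (X τ) (θ τ)) (t 0) →
        Tendsto X atTop (𝓝 Xdes))) := by
  refine ⟨fun X₀ hX₀ h₁ h₂ hc s θ₀ => terminalCond_self hthor hX₀ h₁ h₂ hc s θ₀,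
    fun Xd hXd => ⟨fun X₀ hX₀ s θ₀ => hA2.exists_trajectory hε hthor hXd hX₀ s θ₀,
      fun x ϑ s s' hx hs => hA1.mem_Q hXd hx hs⟩, fun N hN => ?_, fun h => ?_⟩
  · obtain ⟨hmem, hT⟩ := hN.feasible ht hA1 hA2 hε hthor
    refine ⟨hT, hT.exists_trajectory hA1 hA2 hε hthor hmem, fun τ hτ x ϑ hx h1 h2 => ?_⟩
    rw [← h1, ← h2] at hT
    refine ⟨by simp, ?_⟩
    rw [adjust_zero]
    exact hT.of_trajectory hA1 hA2 hε hthor hmem hτ hx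
  · obtain ⟨N, hN⟩ := eventually_target_eq ht ht_top hA1 hA2 hε hthor hδ hδε h
    have hdes := right_mem_segment ℝ (Xt 0) Xdes
    have hT : t 0 ≤ t N + thor := by linarith [ht.monotone (Nat.zero_le N)]
    have hQ := mem_Q_of_target_const ht ht_top hA1 hA2 hε hthor h hN
    have hU : ∀ τ ≥ t N + thor, Usat par Xdes (X τ) (θ τ) = Uunc par Xdes (X τ) (θ τ) :=
      fun τ hτ => Usat_eq_Uunc hA1 hA3 hdes (hQ τ hτ) (θ τ)
    have htraj : IsTrajectory par (Uunc par Xdes) X θ (Ici (t N + thor)) :=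
      ((isTrajectory_of_target_const ht ht_top h hN).mono
        (Ici_subset_Ici.2 (by linarith))).of_feedback_eq hU
    exact ⟨⟨N, hN⟩, ⟨_, hT, hQ, hU, htraj⟩, htraj.tendsto_of_persistentlyExciting hT
      (isCompact_Q par c₀ Xdes) (hA2.Q_subset_regular hε hthor hdes) hQ⟩
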